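/- Let $G$ be a connected reductive linear algebraic group over $\mathbb C$, $K\subset G$ a maximal compact subgroup, $\rho:G\to \mathrm{GL}(V)$ a faithful rational representation on a finite-dimensional complex vector space, and $\widetilde K\subset\mathrm{GL}(V)$ a maximal compact subgroup with $\rho(K)\subset\widetilde K$. Let $X$ be a compact connected Riemann surface, $E_K$ a $C^\infty$ principal $K$-bundle on $X$, $E_G=E_K\times_K G$, and $W=E_K\times_K V$. Let $\mathcal A_0$ (respectively, $\mathcal A(W)$) be the space of holomorphic structures ($\bar\partial$-operators) on $E_G$ (respectively, on $W$); it is an affine space for $A^{0,1}(\mathrm{ad}\,E_G)$ (respectively, $A^{0,1}(\mathrm{End}\,W)$). Put $$\mathcal B_0=\mathcal A_0\times A^{1,0}(\mathrm{ad}\,E_G),\qquad \mathcal B_W=\mathcal A(W)\times A^{1,0}(\mathrm{End}\,W),$$ with the $C^\infty$ topologies on the spaces of forms, and let $\varphi:\mathcal B_0\to\mathcal B_W$ send $(\bar\partial,\theta)$ to $(\bar\partial_W,\theta_W)$, the holomorphic structure on $W$ induced by $\bar\partial$ and the image of $\theta$ under the homomorphism $\mathrm{ad}\,E_G\to\mathrm{End}\,W$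 given by $d\rho$. Give $\mathrm{End}(V)=\mathrm{Lie}(\widetilde K)\oplus\sqrt{-1}\,\mathrm{Lie}(\widetilde K)$ the Hermitian inner product that extends $\langle A,B\rangle=-\mathrm{trace}(AB)$ on $\mathrm{Lie}(\widetilde K)$, and give $\mathfrak g=\mathfrak k\oplus\sqrt{-1}\,\mathfrak k$ the Hermitian inner product that extends $-\mathrm{trace}(d\rho(A)\,d\rho(B))$ on $\mathfrak k=\mathrm{Lie}(K)$. With the induced inner products on the fibres of $\mathrm{ad}\,E_G$ and $\mathrm{End}\,W$, the translation invariant Hermitian inner products on the tangent spaces $A^{0,1}\oplus A^{1,0}$ given by $$\|(\omega_{0,1},\omega_{1,0})\|^2=\sqrt{-1}\int_X\langle\omega_{1,0},\overline{\omega_{1,0}}\rangle-\sqrt{-1}\int_X\langle\omega_{0,1},\overline{\omega_{0,1}}\rangle$$ define Kähler structures on $\mathcal B_0$ and $\mathcal B_W$: the Riemannian metric $g$ is the real part, and the Kähler form is $\Omega(u,v)=g(\sqrt{-1}\,u,v)$. Then $\varphi$ is injective and differentiable along lines, and it preserves the Kähler forms: $\varphi^*\Omega_{\mathcal B_W}=\Omega_{\mathcal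 B_0}$. The second fundamental form of $\varphi$, that is, the component of $\nabla_u(d\varphi(v))$ normal to the image of $d\varphi$, where $\nabla$ is the Levi-Civita connection of $\mathcal B_W$, exists and vanishes. In particular, $\varphi$ is totally geodesic: it maps geodesics of $\mathcal B_0$ to geodesics of $\mathcal B_W$. -/

import Mathlib

open scoped Manifold ContDiff Topology

noncomputable section

namespace PrincipalHiggs

/-! ## Linear algebraic groups, their Lie algebras, and rational representations

A linear algebraic group is a Zariski closed subgroup `G` of `GL(U)`, where `U` is a
finite-dimensional complex vector space. (The norm on `U` only serves to name the usual topology.) -/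

section Groups

variable {U : Type*} [NormedAddCommGroup U] [NormedSpace ℂ U]
variable {V : Type*} [NormedAddCommGroup V] [NormedSpace ℂ V]

/-- The group `GL(U)`. -/
abbrev GLin (U : Type*) [NormedAddCommGroup U] [NormedSpace ℂ U] := (U →L[ℂ] U)ˣ

/-- The algebra of regular functions on `GL(U)`: the polynomials in the entries of `M` and of
`M⁻¹`. They are written as functions on `End U`; only their values at invertible `M` matter. -/
def regularFunctions (U : Type*) [NormedAddCommGroup U] [NormedSpace ℂ U] :
    Subalgebra ℂ ((U →L[ℂ] U) → ℂ) :=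
  Algebra.adjoin ℂ
    ({f | ∃ l : (U →L[ℂ] U) →L[ℂ] ℂ, f = fun M => l M} ∪
      {f | ∃ l : (U →L[ℂ] U) →L[ℂ] ℂ, f = fun M => l (Ring.inverse M)})

/-- Maps `GL(U) → End V` all of whose components are regular functions. -/
def IsRegularMap (R : (U →L[ℂ] U) → (V →L[ℂ] V)) : Prop :=
  ∀ l : (V →L[ℂ] V) →L[ℂ] ℂ, (fun M => l (R M)) ∈ regularFunctions U

/-- `G` is Zariski closed in `GL(U)`. -/
def IsAlgebraicSubgroup (G : Subgroup (GLin U)) : Prop :=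
  ∃ S : Set ((U →L[ℂ] U) → ℂ), S ⊆ regularFunctions U ∧
    ∀ g : GLin U, g ∈ G ↔ ∀ f ∈ S, f (g : U →L[ℂ] U) = 0

/-- The Lie algebra `𝔤 ⊆ End U` of an algebraic group `G ⊆ GL(U)`: the Zariski tangent space of
`G` at the identity. -/
def lieAlgebra (G : Subgroup (GLin U)) : Submodule ℂ (U →L[ℂ] U) where
  carrier := {A | ∀ f ∈ regularFunctions U, (∀ g ∈ G, f ((g : GLin U) : U →L[ℂ] U) = 0) →
    fderiv ℂ f 1 A = 0}
  zero_mem' := by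
    intro f _ _
    simp
  add_mem' := by
    intro A B hA hB f hf h
    rw [map_add, hA f hf h, hB f hf h, add_zero]
  smul_mem' := by
    intro c A hA f hf h
    rw [map_smul, hA f hf h, smul_zero]

/-- The real Lie algebra of a closed subgroup `K ⊆ GL(U)`:
all `A` such that `exp (t A) ∈ K` for all real `t`. -/
def realLieAlgebra (K : Subgroup (GLin U)) : Set (U →L[ℂ] U) :=
  {A | ∀ t : ℝ, ∃ k ∈ K, ((k : GLin U) : U →L[ℂ] U) = NormedSpace.exp (t • A)}

/-- `K` is a maximal compact subgroup of `G`. -/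
structure IsMaximalCompact (K G : Subgroup (GLin U)) : Prop where
  le : K ≤ G
  compact : IsCompact (K : Set (GLin U))
  maximal : ∀ K' : Subgroup (GLin U), K' ≤ G → IsCompact (K' : Set (GLin U)) → K ≤ K' → K' = K

/-- Connected reductive linear algebraic groups over `ℂ`. A connected complex linear algebraic
group is reductive when it is the complexification of its maximal compact subgroups, that is, when
`𝔤 = 𝔨 ⊕ √-1 𝔨` for the Lie algebra `𝔨` of a maximal compact subgroup. -/
structure IsConnectedReductive (G : Subgroup (GLin U)) : Prop where
  algebraic : IsAlgebraicSubgroup G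
  connected : IsConnected (G : Set (GLin U))
  span : ∀ K, IsMaximalCompact K G → ∀ A : U →L[ℂ] U,
    A ∈ lieAlgebra G ↔
      ∃ A₁ ∈ realLieAlgebra K, ∃ A₂ ∈ realLieAlgebra K, A = A₁ + Complex.I • A₂
  direct : ∀ K, IsMaximalCompact K G → ∀ A ∈ realLieAlgebra K,
    Complex.I • A ∈ realLieAlgebra K → A = 0

/-- A rational representation `ρ : G → GL(V)`, that is, a morphism of algebraic groups. -/
structure RationalRep (G : Subgroup (GLin U)) (V : Type*) [NormedAddCommGroup V]
    [NormedSpace ℂ V] where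
  toHom : G →* GLin V
  regular : ∃ R : (U →L[ℂ] U) → (V →L[ℂ] V), IsRegularMap R ∧
    ∀ g : G, R ((g : GLin U) : U →L[ℂ] U) = (toHom g : V →L[ℂ] V)

variable {G : Subgroup (GLin U)}

/-- A regular map on `GL(U)` that extends `ρ`. -/
def RationalRep.ext (ρ : RationalRep G V) : (U →L[ℂ] U) → (V →L[ℂ] V) := ρ.regular.choose

theorem RationalRep.ext_regular (ρ : RationalRep G V) : IsRegularMap ρ.ext :=
  ρ.regular.choose_spec.1

theorem RationalRep.ext_apply (ρ : RationalRep G V) (g : G) :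
    ρ.ext ((g : GLin U) : U →L[ℂ] U) = (ρ.toHom g : V →L[ℂ] V) :=
  ρ.regular.choose_spec.2 g

/-- The differential of `ρ` at the identity. It is meaningful on `𝔤 = lieAlgebra G`, and there it
does not depend on the extension of `ρ` to `GL(U)` (see `RationalRep.differential_eq`). -/
def RationalRep.differential (ρ : RationalRep G V) : (U →L[ℂ] U) →L[ℂ] (V →L[ℂ] V) :=
  fderiv ℂ ρ.ext 1

theorem inverse_mul_unit (M : U →L[ℂ] U) (b : GLin U) :
    Ring.inverse (M * (b : U →L[ℂ] U)) = ((b⁻¹ : GLin U) : U →L[ℂ] U) * Ring.inverse M := by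
  by_cases h : IsUnit M
  · obtain ⟨m, rfl⟩ := h
    rw [← Units.val_mul, Ring.inverse_unit, Ring.inverse_unit, mul_inv_rev, Units.val_mul]
  · rw [Ring.inverse_non_unit _ h, Ring.inverse_non_unit, mul_zero]
    rwa [Units.isUnit_mul_units]

theorem inverse_unit_mul (M : U →L[ℂ] U) (b : GLin U) :
    Ring.inverse ((b : U →L[ℂ] U) * M) = Ring.inverse M * ((b⁻¹ : GLin U) : U →L[ℂ] U) := by
  by_cases h : IsUnit M
  · obtain ⟨m, rfl⟩ := h
    rw [← Units.val_mul, Ring.inverse_unit, Ring.inverse_unit, mul_inv_rev, Units.val_mul]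
  · rw [Ring.inverse_non_unit _ h, Ring.inverse_non_unit, zero_mul]
    rwa [Units.isUnit_units_mul]

/-- Regular functions are stable under two-sided translations. -/
theorem regularFunctions_translate (a b : GLin U) {f : (U →L[ℂ] U) → ℂ}
    (hf : f ∈ regularFunctions U) :
    (fun M : U →L[ℂ] U => f ((a : U →L[ℂ] U) * M * (b : U →L[ℂ] U))) ∈ regularFunctions U := by
  unfold regularFunctions at hf
  induction hf using Algebra.adjoin_induction with
  | mem f hf =>
    refine Algebra.subset_adjoin ?_
    rcases hf with ⟨l, rfl⟩ | ⟨l, rfl⟩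
    · refine Or.inl ⟨l.comp ((ContinuousLinearMap.mul ℂ (U →L[ℂ] U)).flip b |>.comp
        (ContinuousLinearMap.mul ℂ (U →L[ℂ] U) a)), ?_⟩
      funext M
      simp
    · refine Or.inr ⟨l.comp ((ContinuousLinearMap.mul ℂ (U →L[ℂ] U)).flip
        ((a⁻¹ : GLin U) : U →L[ℂ] U) |>.comp
        (ContinuousLinearMap.mul ℂ (U →L[ℂ] U) ((b⁻¹ : GLin U) : U →L[ℂ] U))), ?_⟩
      funext M
      simp only [inverse_mul_unit, inverse_unit_mul]
      simp [mul_assoc]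
  | algebraMap r => exact (regularFunctions U).algebraMap_mem r
  | add f g _ _ hf hg => exact (regularFunctions U).add_mem hf hg
  | mul f g _ _ hf hg => exact (regularFunctions U).mul_mem hf hg

theorem contDiffAt_of_regular [CompleteSpace U] {f : (U →L[ℂ] U) → ℂ}
    (hf : f ∈ regularFunctions U) (g : GLin U) : ContDiffAt ℂ ∞ f (g : U →L[ℂ] U) := by
  unfold regularFunctions at hf
  induction hf using Algebra.adjoin_induction with
  | mem f hf =>
    rcases hf with ⟨l, rfl⟩ | ⟨l, rfl⟩
    · exact l.contDiff.contDiffAt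
    · exact l.contDiff.contDiffAt.comp _ (contDiffAt_ringInverse ℂ g)
  | algebraMap r => exact contDiffAt_const
  | add f g _ _ hf hg => exact hf.add hg
  | mul f g _ _ hf hg => exact hf.mul hg

theorem IsRegularMap.contDiffAt [FiniteDimensional ℂ U] [FiniteDimensional ℂ V]
    {R : (U →L[ℂ] U) → (V →L[ℂ] V)} (hR : IsRegularMap R) (g : GLin U) :
    ContDiffAt ℂ ∞ R (g : U →L[ℂ] U) := by
  have : CompleteSpace U := FiniteDimensional.complete ℂ U
  let e := ContinuousLinearEquiv.ofFinrankEq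
    (show Module.finrank ℂ (V →L[ℂ] V) =
      Module.finrank ℂ (Fin (Module.finrank ℂ (V →L[ℂ] V)) → ℂ) by simp)
  rw [← e.comp_contDiffAt_iff, contDiffAt_pi]
  intro i
  exact contDiffAt_of_regular (hR ((ContinuousLinearMap.proj i).comp e.toContinuousLinearMap)) g

/-- Two maps that are regular near the identity and agree on `G` have the same derivative along
`𝔤`. -/
theorem fderiv_eq_of_regular [FiniteDimensional ℂ U] [FiniteDimensional ℂ V]
    {R S : (U →L[ℂ] U) → (V →L[ℂ] V)} (hR : IsRegularMap R) (hS : IsRegularMap S)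
    (h : ∀ g ∈ G, R ((g : GLin U) : U →L[ℂ] U) = S (g : U →L[ℂ] U))
    {A : U →L[ℂ] U} (hA : A ∈ lieAlgebra G) : fderiv ℂ R 1 A = fderiv ℂ S 1 A := by
  have dR : DifferentiableAt ℂ R 1 := (hR.contDiffAt 1).differentiableAt (by simp)
  have dS : DifferentiableAt ℂ S 1 := (hS.contDiffAt 1).differentiableAt (by simp)
  rw [← sub_eq_zero]
  refine SeparatingDual.eq_zero_of_forall_dual_eq_zero (R := ℂ) (fun l => ?_)
  have hmem : (fun M => l (R M)) - (fun M => l (S M)) ∈ regularFunctions U :=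
    (regularFunctions U).sub_mem (hR l) (hS l)
  have hz := hA _ hmem (fun g hg => by simp [h g hg])
  have h1 : HasFDerivAt ((fun M => l (R M)) - (fun M => l (S M)))
      (l.comp (fderiv ℂ R 1) - l.comp (fderiv ℂ S 1)) 1 :=
    (l.hasFDerivAt.comp _ dR.hasFDerivAt).sub (l.hasFDerivAt.comp _ dS.hasFDerivAt)
  rw [h1.fderiv] at hz
  simpa using hz

theorem RationalRep.differential_eq [FiniteDimensional ℂ U] [FiniteDimensional ℂ V]
    (ρ : RationalRep G V) {R : (U →L[ℂ] U) → (V →L[ℂ] V)} (hR : IsRegularMap R)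
    (h : ∀ g : G, R ((g : GLin U) : U →L[ℂ] U) = (ρ.toHom g : V →L[ℂ] V))
    {A : U →L[ℂ] U} (hA : A ∈ lieAlgebra G) : ρ.differential A = fderiv ℂ R 1 A :=
  fderiv_eq_of_regular ρ.ext_regular hR
    (fun g hg => by rw [ρ.ext_apply ⟨g, hg⟩, h ⟨g, hg⟩]) hA

end Groups

/-! ## Forms on a Riemann surface -/

section Auxiliary

variable {U : Type*} [NormedAddCommGroup U] [NormedSpace ℂ U]
variable {V : Type*} [NormedAddCommGroup V] [NormedSpace ℂ V]

/-- The linear map `M ↦ S M T`. -/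
def mulLeftRight (S T : U →L[ℂ] U) : (U →L[ℂ] U) →L[ℂ] (U →L[ℂ] U) :=
  ((ContinuousLinearMap.mul ℂ (U →L[ℂ] U)).flip T).comp (ContinuousLinearMap.mul ℂ (U →L[ℂ] U) S)

theorem mulLeftRight_apply (S T M : U →L[ℂ] U) : mulLeftRight S T M = S * M * T := rfl

theorem IsRegularMap.translate {R : (U →L[ℂ] U) → (V →L[ℂ] V)} (hR : IsRegularMap R)
    (a b : GLin U) :
    IsRegularMap fun M : U →L[ℂ] U => R ((a : U →L[ℂ] U) * M * (b : U →L[ℂ] U)) :=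
  fun l => regularFunctions_translate a b (hR l)

theorem IsRegularMap.mul {R : (U →L[ℂ] U) → (V →L[ℂ] V)} (hR : IsRegularMap R)
    (S T : V →L[ℂ] V) : IsRegularMap fun M : U →L[ℂ] U => S * R M * T := by
  intro l
  have := hR (l.comp (((ContinuousLinearMap.mul ℂ (V →L[ℂ] V)).flip T).comp
    (ContinuousLinearMap.mul ℂ (V →L[ℂ] V) S)))
  simpa using this

end Auxiliary

section Forms

variable {U : Type*} [NormedAddCommGroup U] [NormedSpace ℂ U]
variable {V : Type*} [NormedAddCommGroup V] [NormedSpace ℂ V]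
variable {X : Type*} [TopologicalSpace X] [ChartedSpace ℂ X]

/-- The tangent vector `D(e⁻¹)_z(w)` at `e⁻¹(z)`, for a chart `e` and `w ∈ ℂ`. So `w = 1` and
`w = √-1` give the coordinate vectors `∂/∂x` and `∂/∂y` of the coordinate `e = x + √-1 y`. -/
def coordVec (e : OpenPartialHomeomorph X ℂ) (z w : ℂ) : TangentSpace 𝓘(ℂ, ℂ) (e.symm z) :=
  mfderiv 𝓘(ℂ, ℂ) 𝓘(ℂ, ℂ) e.symm z w

/-- The real differential of a function `f : X → F`. -/
def realDifferential {F : Type*} [NormedAddCommGroup F] [NormedSpace ℂ F] (f : X → F) (x : X)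
    (v : TangentSpace 𝓘(ℂ, ℂ) x) : F :=
  let D : ℂ →L[ℝ] F := mfderiv 𝓘(ℝ, ℂ) 𝓘(ℝ, F) f x
  D v

/-- The `(0,1)`-part of the differential: `(∂̄f)(v) = (df(v) + √-1 df(√-1 v)) / 2`. -/
def dbar {F : Type*} [NormedAddCommGroup F] [NormedSpace ℂ F] (f : X → F) (x : X)
    (v : TangentSpace 𝓘(ℂ, ℂ) x) : F :=
  (1 / 2 : ℂ) • (realDifferential f x v + Complex.I • realDifferential f x (Complex.I • v))

theorem dbar_comp {f : X → (U →L[ℂ] U)} {x : X} {R : (U →L[ℂ] U) → (V →L[ℂ] V)}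
    (hf : MDifferentiableAt 𝓘(ℝ, ℂ) 𝓘(ℝ, U →L[ℂ] U) f x) (hR : DifferentiableAt ℂ R (f x))
    (v : TangentSpace 𝓘(ℂ, ℂ) x) :
    dbar (fun y => R (f y)) x v = fderiv ℂ R (f x) (dbar f x v) := by
  have h : ∀ w : TangentSpace 𝓘(ℂ, ℂ) x, realDifferential (fun y => R (f y)) x w =
      fderiv ℂ R (f x) (realDifferential f x w) := by
    intro w
    have h1 := (hR.hasFDerivAt.restrictScalars ℝ).hasMFDerivAt
    have h2 := (h1.comp x hf.hasMFDerivAt).mfderiv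
    simp only [Function.comp_def] at h2
    simp only [realDifferential]
    rw [h2]
    rfl
  simp only [dbar, h, map_smul, map_add]

theorem exists_chart_partition [T2Space X] [CompactSpace X] :
    ∃ f : PartitionOfUnity X X Set.univ, f.IsSubordinate fun x => (chartAt ℂ x).source :=
  PartitionOfUnity.exists_isSubordinate isClosed_univ _ (fun x => (chartAt ℂ x).open_source)
    (fun x _ => Set.mem_iUnion.2 ⟨x, mem_chart_source ℂ x⟩)

/-- The integral `∫_X η` of a complex valued 2-form over a compact Riemann surface (with its
complex orientation): the sum over a partition of unity of the integrals of `η(∂/∂x, ∂/∂y) dx dy`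
in the charts. -/
def integral2 [T2Space X] [CompactSpace X]
    (η : (x : X) → TangentSpace 𝓘(ℂ, ℂ) x → TangentSpace 𝓘(ℂ, ℂ) x → ℂ) : ℂ :=
  ∑ᶠ x₀ : X, ∫ z in (chartAt ℂ x₀).target,
    ((exists_chart_partition (X := X)).choose x₀ ((chartAt ℂ x₀).symm z) : ℂ) *
      η ((chartAt ℂ x₀).symm z) (coordVec (chartAt ℂ x₀) z 1)
        (coordVec (chartAt ℂ x₀) z Complex.I)

end Forms

/-! ## Principal bundles and the associated spaces of forms -/

section Bundles

variable {U : Type*} [NormedAddCommGroup U] [NormedSpace ℂ U]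
variable {V : Type*} [NormedAddCommGroup V] [NormedSpace ℂ V]
variable {X : Type*} [TopologicalSpace X] [ChartedSpace ℂ X] {ι : Type*}

/-- A smooth complex vector bundle with typical fibre `U`, and at the same time its frame bundle,
given by an open cover and smooth transition functions `g i j` with values in `GL(U)`. A section is
a family of functions `s i` on `base i` with `s i = g i j (s j)`. -/
structure Cocycle (ι X U : Type*) [TopologicalSpace X] [ChartedSpace ℂ X]
    [NormedAddCommGroup U] [NormedSpace ℂ U] where
  base : ι → Set X
  isOpen_base : ∀ i, IsOpen (base i)
  cover : ∀ x, ∃ i, x ∈ base i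
  g : ι → ι → X → GLin U
  smooth : ∀ i j, ContMDiffOn 𝓘(ℝ, ℂ) 𝓘(ℝ, U →L[ℂ] U) ∞
    (fun x => (g i j x : U →L[ℂ] U)) (base i ∩ base j)
  cocycle : ∀ i j k, ∀ x ∈ base i ∩ base j ∩ base k, g i j x * g j k x = g i k x

/-- A smooth principal `K`-bundle on `X`, for a closed subgroup `K` of `GL(U)`, given by an open
cover and smooth `K`-valued transition functions. (A map into the closed subgroup `K` is smooth if
and only if it is smooth as a map to `End U`.) The same transition functions define the extension
of its structure group to any larger subgroup of `GL(U)`. -/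
structure PrincipalBundle (ι X : Type*) [TopologicalSpace X] [ChartedSpace ℂ X]
    (K : Subgroup (GLin U)) extends Cocycle ι X U where
  mem : ∀ i j x, g i j x ∈ K

/-- Smooth 1-forms on `X` of type `(1,0)` (for `σ = id`) or `(0,1)` (for `σ` the complex
conjugation) with values in the bundle associated to the adjoint action on `𝔤 ⊆ End U`, written in
the local frames over `base i`, and set to zero outside `base i`. -/
@[ext]
structure AdForm (σ : ℂ →+* ℂ) (c : Cocycle ι X U) (𝔤 : Submodule ℂ (U →L[ℂ] U)) where
  val : ι → (x : X) → TangentSpace 𝓘(ℂ, ℂ) x →SL[σ] (U →L[ℂ] U)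
  mem : ∀ i x v, val i x v ∈ 𝔤
  off : ∀ i, ∀ x ∉ c.base i, val i x = 0
  equivariant : ∀ i j, ∀ x ∈ c.base i ∩ c.base j, ∀ v,
    val i x v = (c.g i j x : U →L[ℂ] U) * val j x v * ((c.g i j x)⁻¹ : GLin U)
  smooth : ∀ i, ∀ e ∈ atlas ℂ X, ContDiffOn ℝ ∞
    (fun z => val i (e.symm z) (coordVec e z 1)) (e.target ∩ e.symm ⁻¹' c.base i)

/-- The holomorphic structures on the smooth principal `G`-bundle with transition functions `c`,
as `∂̄`-operators: over `base i` the operator is `∂̄ + a i` with a smooth `(0,1)`-form `a i` with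
values in the Lie algebra `𝔤` of `G`, and `a i = g (a j) g⁻¹ - (∂̄g) g⁻¹` for `g = g i j`. (On a
Riemann surface every such operator is integrable.) For `𝔤 = End U` these are the holomorphic
structures on the vector bundle with transition functions `c`. -/
@[ext]
structure HolStructure (c : Cocycle ι X U) (𝔤 : Submodule ℂ (U →L[ℂ] U)) where
  val : ι → (x : X) → TangentSpace 𝓘(ℂ, ℂ) x →SL[starRingEnd ℂ] (U →L[ℂ] U)
  mem : ∀ i x v, val i x v ∈ 𝔤
  off : ∀ i, ∀ x ∉ c.base i, val i x = 0
  gauge : ∀ i j, ∀ x ∈ c.base i ∩ c.base j, ∀ v,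
    val i x v = (c.g i j x : U →L[ℂ] U) * val j x v * ((c.g i j x)⁻¹ : GLin U) -
      dbar (fun y => (c.g i j y : U →L[ℂ] U)) x v * ((c.g i j x)⁻¹ : GLin U)
  smooth : ∀ i, ∀ e ∈ atlas ℂ X, ContDiffOn ℝ ∞
    (fun z => val i (e.symm z) (coordVec e z 1)) (e.target ∩ e.symm ⁻¹' c.base i)

namespace AdForm

variable {σ : ℂ →+* ℂ} {c : Cocycle ι X U} {𝔤 : Submodule ℂ (U →L[ℂ] U)}

instance : Zero (AdForm σ c 𝔤) :=
  ⟨{ val := 0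
     mem := fun i x v => 𝔤.zero_mem
     off := fun i x _ => rfl
     equivariant := fun i j x _ v => by simp
     smooth := fun i e _ => contDiffOn_const }⟩

instance : Add (AdForm σ c 𝔤) :=
  ⟨fun a b =>
   { val := a.val + b.val
     mem := fun i x v => 𝔤.add_mem (a.mem i x v) (b.mem i x v)
     off := fun i x h => by simp [a.off i x h, b.off i x h]
     equivariant := fun i j x h v => by
       simp only [Pi.add_apply, add_apply]
       rw [a.equivariant i j x h v, b.equivariant i j x h v, mul_add, add_mul]
     smooth := fun i e he => (a.smooth i e he).add (b.smooth i e he) }⟩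

instance : Neg (AdForm σ c 𝔤) :=
  ⟨fun a =>
   { val := -a.val
     mem := fun i x v => 𝔤.neg_mem (a.mem i x v)
     off := fun i x h => by simp [a.off i x h]
     equivariant := fun i j x h v => by
       simp only [Pi.neg_apply, neg_apply]
       rw [a.equivariant i j x h v, mul_neg, neg_mul]
     smooth := fun i e he => (a.smooth i e he).neg }⟩

instance : Sub (AdForm σ c 𝔤) :=
  ⟨fun a b =>
   { val := a.val - b.val
     mem := fun i x v => 𝔤.sub_mem (a.mem i x v) (b.mem i x v)
     off := fun i x h => by simp [a.off i x h, b.off i x h]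
     equivariant := fun i j x h v => by
       simp only [Pi.sub_apply, sub_apply]
       rw [a.equivariant i j x h v, b.equivariant i j x h v, mul_sub, sub_mul]
     smooth := fun i e he => (a.smooth i e he).sub (b.smooth i e he) }⟩

instance : SMul ℂ (AdForm σ c 𝔤) :=
  ⟨fun s a =>
   { val := fun i x => s • a.val i x
     mem := fun i x v => 𝔤.smul_mem _ (a.mem i x v)
     off := fun i x h => by
       ext1 v
       simp only [a.off i x h, smul_apply, zero_apply]
       exact smul_zero s
     equivariant := fun i j x h v => by
       simp only [smul_apply]
       rw [a.equivariant i j x h v, mul_smul_comm, smul_mul_assoc]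
     smooth := fun i e he => (a.smooth i e he).const_smul s }⟩

instance : AddCommGroup (AdForm σ c 𝔤) where
  add_assoc a b d := AdForm.ext (add_assoc _ _ _)
  zero_add a := AdForm.ext (zero_add _)
  add_zero a := AdForm.ext (add_zero _)
  neg_add_cancel a := AdForm.ext (neg_add_cancel _)
  add_comm a b := AdForm.ext (add_comm _ _)
  sub_eq_add_neg a b := AdForm.ext (sub_eq_add_neg _ _)
  nsmul := nsmulRec
  zsmul := zsmulRec

instance : Module ℂ (AdForm σ c 𝔤) where
  one_smul a := by
    ext i x v
    exact congrArg (fun T : U →L[ℂ] U => T _) (one_smul ℂ (a.val i x v))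
  mul_smul s t a := by
    ext i x v
    exact congrArg (fun T : U →L[ℂ] U => T _) (mul_smul s t (a.val i x v))
  smul_zero s := by
    ext i x v
    exact congrArg (fun T : U →L[ℂ] U => T _) (smul_zero s)
  smul_add s a b := by
    ext i x v
    exact congrArg (fun T : U →L[ℂ] U => T _) (smul_add s (a.val i x v) (b.val i x v))
  add_smul s t a := by
    ext i x v
    exact congrArg (fun T : U →L[ℂ] U => T _) (add_smul s t (a.val i x v))
  zero_smul a := by
    ext i x v
    exact congrArg (fun T : U →L[ℂ] U => T _) (zero_smul ℂ (a.val i x v))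

/-- The coefficient of a form in the chart `e` and the local frame over `base i`. -/
def coeff (a : AdForm σ c 𝔤) (i : ι) (e : OpenPartialHomeomorph X ℂ) (z : ℂ) : U →L[ℂ] U :=
  a.val i (e.symm z) (coordVec e z 1)

theorem contDiffOn_coeff (a : AdForm σ c 𝔤) (i : ι) (e : OpenPartialHomeomorph X ℂ)
    (he : e ∈ atlas ℂ X) :
    ContDiffOn ℝ ∞ (a.coeff i e) (e.target ∩ e.symm ⁻¹' c.base i) :=
  a.smooth i e he

theorem isOpen_dom (c : Cocycle ι X U) (i : ι) (e : OpenPartialHomeomorph X ℂ) :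
    IsOpen (e.target ∩ e.symm ⁻¹' c.base i) :=
  e.symm.isOpen_inter_preimage (c.isOpen_base i)

/-- Indices of the seminorms: a frame, a chart, an order of differentiation, and a compact subset
of the common domain in the chart. -/
structure SeminormIndex (c : Cocycle ι X U) where
  i : ι
  e : OpenPartialHomeomorph X ℂ
  he : e ∈ atlas ℂ X
  k : ℕ
  C : Set ℂ
  compact : IsCompact C
  subset : C ⊆ e.target ∩ e.symm ⁻¹' c.base i

theorem contDiffAt_coeff (a : AdForm σ c 𝔤) (s : SeminormIndex c) (z : s.C) :
    ContDiffAt ℝ ∞ (a.coeff s.i s.e) z :=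
  (a.contDiffOn_coeff s.i s.e s.he).contDiffAt ((isOpen_dom c s.i s.e).mem_nhds (s.subset z.2))

theorem bddAbove_coeff (a : AdForm σ c 𝔤) (s : SeminormIndex c) :
    BddAbove (Set.range fun z : s.C => ‖iteratedFDeriv ℝ s.k (a.coeff s.i s.e) z‖) := by
  have h : ContinuousOn (fun z => ‖iteratedFDeriv ℝ s.k (a.coeff s.i s.e) z‖) s.C := by
    intro z hz
    have h1 := a.contDiffAt_coeff s ⟨z, hz⟩
    exact ((h1.iteratedFDeriv_right (m := 0)
      (by rw [zero_add]; exact_mod_cast le_top)).continuousAt.norm).continuousWithinAt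
  have := s.compact.bddAbove_image h
  rwa [Set.image_eq_range] at this

/-- The seminorm `sup_C ‖D^k a‖`. -/
def supSeminorm (s : SeminormIndex c) : Seminorm ℝ (AdForm σ c 𝔤) where
  toFun a := ⨆ z : s.C, ‖iteratedFDeriv ℝ s.k (a.coeff s.i s.e) z‖
  map_zero' := by
    have h : (0 : AdForm σ c 𝔤).coeff s.i s.e = 0 := rfl
    simp [h]
  add_le' a b := by
    refine Real.iSup_le (fun z => ?_) (add_nonneg (Real.iSup_nonneg fun _ => norm_nonneg _)
      (Real.iSup_nonneg fun _ => norm_nonneg _))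
    have h : (a + b).coeff s.i s.e = a.coeff s.i s.e + b.coeff s.i s.e := rfl
    have ha := (a.contDiffAt_coeff s z).of_le (m := (s.k : ℕ∞)) (by exact_mod_cast le_top)
    have hb := (b.contDiffAt_coeff s z).of_le (m := (s.k : ℕ∞)) (by exact_mod_cast le_top)
    rw [h, iteratedFDeriv_add_apply ha hb]
    exact (norm_add_le _ _).trans
      (add_le_add (le_ciSup (a.bddAbove_coeff s) z) (le_ciSup (b.bddAbove_coeff s) z))
  neg' a := by
    have h : (-a).coeff s.i s.e = -a.coeff s.i s.e := rfl
    simp [h, iteratedFDeriv_neg]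
  smul' r a := by
    have h : (r • a).coeff s.i s.e = (r : ℂ) • a.coeff s.i s.e := rfl
    rw [h, Real.norm_eq_abs, Real.mul_iSup_of_nonneg (abs_nonneg r)]
    refine iSup_congr fun z => ?_
    have ha := (a.contDiffAt_coeff s z).of_le (m := (s.k : ℕ∞)) (by exact_mod_cast le_top)
    rw [iteratedFDeriv_const_smul_apply ha, norm_smul]
    simp

/-- The `C^∞` topology: uniform convergence of all derivatives on compact sets. -/
instance : TopologicalSpace (AdForm σ c 𝔤) :=
  ⨅ s : SeminormIndex c,
    (supSeminorm (σ := σ) (𝔤 := 𝔤) s).toSeminormedAddCommGroup.toUniformSpace.toTopologicalSpace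

end AdForm

namespace HolStructure

variable {c : Cocycle ι X U} {𝔤 : Submodule ℂ (U →L[ℂ] U)}

/-- `A^{0,1}(ad)` acts on the holomorphic structures by translations. -/
instance : VAdd (AdForm (starRingEnd ℂ) c 𝔤) (HolStructure c 𝔤) :=
  ⟨fun a D =>
   { val := a.val + D.val
     mem := fun i x v => 𝔤.add_mem (a.mem i x v) (D.mem i x v)
     off := fun i x h => by simp [a.off i x h, D.off i x h]
     gauge := fun i j x h v => by
       simp only [Pi.add_apply, add_apply]
       rw [a.equivariant i j x h v, D.gauge i j x h v, mul_add, add_mul, add_sub_assoc]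
     smooth := fun i e he => (a.smooth i e he).add (D.smooth i e he) }⟩

/-- The difference of two holomorphic structures. -/
instance : VSub (AdForm (starRingEnd ℂ) c 𝔤) (HolStructure c 𝔤) :=
  ⟨fun D D' =>
   { val := D.val - D'.val
     mem := fun i x v => 𝔤.sub_mem (D.mem i x v) (D'.mem i x v)
     off := fun i x h => by simp [D.off i x h, D'.off i x h]
     equivariant := fun i j x h v => by
       simp only [Pi.sub_apply, sub_apply]
       rw [D.gauge i j x h v, D'.gauge i j x h v, mul_sub, sub_mul]
       abel
     smooth := fun i e he => (D.smooth i e he).sub (D'.smooth i e he) }⟩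

instance : AddAction (AdForm (starRingEnd ℂ) c 𝔤) (HolStructure c 𝔤) where
  zero_vadd D := HolStructure.ext (zero_add D.val)
  add_vadd a b D := HolStructure.ext (add_assoc a.val b.val D.val)

/-- The holomorphic structures form an affine space over `A^{0,1}(ad)`. -/
theorem vsub_vadd_cancel (D D' : HolStructure c 𝔤) : (D -ᵥ D') +ᵥ D' = D :=
  HolStructure.ext (sub_add_cancel D.val D'.val)

theorem vadd_vsub_cancel (a : AdForm (starRingEnd ℂ) c 𝔤) (D : HolStructure c 𝔤) :
    (a +ᵥ D) -ᵥ D = a :=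
  AdForm.ext (add_sub_cancel_right a.val D.val)

end HolStructure

/-- The space `𝓑 = 𝓐 × A^{1,0}(ad)` of pairs of a holomorphic structure and a `(1,0)`-form. -/
@[ext]
structure HiggsSpace (c : Cocycle ι X U) (𝔤 : Submodule ℂ (U →L[ℂ] U)) where
  dbar : HolStructure c 𝔤
  higgs : AdForm (RingHom.id ℂ) c 𝔤

/-- The vector space `A^{0,1}(ad) ⊕ A^{1,0}(ad)`, the tangent space of `𝓑` at each point. -/
abbrev HiggsTangent (c : Cocycle ι X U) (𝔤 : Submodule ℂ (U →L[ℂ] U)) :=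
  AdForm (starRingEnd ℂ) c 𝔤 × AdForm (RingHom.id ℂ) c 𝔤

namespace HiggsSpace

variable {c : Cocycle ι X U} {𝔤 : Submodule ℂ (U →L[ℂ] U)}

instance : AddAction (HiggsTangent c 𝔤) (HiggsSpace c 𝔤) where
  vadd u p := ⟨u.1 +ᵥ p.dbar, u.2 + p.higgs⟩
  zero_vadd p := HiggsSpace.ext (zero_vadd _ p.dbar) (zero_add p.higgs)
  add_vadd u v p := HiggsSpace.ext (add_vadd u.1 v.1 p.dbar) (add_assoc u.2 v.2 p.higgs)

instance : VSub (HiggsTangent c 𝔤) (HiggsSpace c 𝔤) :=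
  ⟨fun p q => (p.dbar -ᵥ q.dbar, p.higgs - q.higgs)⟩

/-- `𝓑` is an affine space over `A^{0,1}(ad) ⊕ A^{1,0}(ad)`. -/
theorem vsub_vadd_cancel (p q : HiggsSpace c 𝔤) : (p -ᵥ q) +ᵥ q = p :=
  HiggsSpace.ext (HolStructure.vsub_vadd_cancel p.dbar q.dbar) (sub_add_cancel p.higgs q.higgs)

theorem vadd_vsub_cancel (u : HiggsTangent c 𝔤) (p : HiggsSpace c 𝔤) : (u +ᵥ p) -ᵥ p = u :=
  Prod.ext (HolStructure.vadd_vsub_cancel u.1 p.dbar) (add_sub_cancel_right u.2 p.higgs)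

end HiggsSpace

end Bundles

/-! ## Change of structure group along a representation -/

section Embedding

variable {U : Type*} [NormedAddCommGroup U] [NormedSpace ℂ U] [FiniteDimensional ℂ U]
variable {V : Type*} [NormedAddCommGroup V] [NormedSpace ℂ V] [FiniteDimensional ℂ V]
variable {G : Subgroup (GLin U)}

theorem conj_mem_lieAlgebra {g : GLin U} (hg : g ∈ G) {A : U →L[ℂ] U}
    (hA : A ∈ lieAlgebra G) :
    (g : U →L[ℂ] U) * A * ((g⁻¹ : GLin U) : U →L[ℂ] U) ∈ lieAlgebra G := by
  have : CompleteSpace U := FiniteDimensional.complete ℂ U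
  intro f hf h
  have h0 := hA _ (regularFunctions_translate g g⁻¹ hf) (fun k hk => by
    have := h (g * k * g⁻¹) (G.mul_mem (G.mul_mem hg hk) (G.inv_mem hg))
    simpa using this)
  have hd : HasFDerivAt f (fderiv ℂ f 1)
      (mulLeftRight (g : U →L[ℂ] U) ((g⁻¹ : GLin U) : U →L[ℂ] U) 1) := by
    have := ((contDiffAt_of_regular hf 1).differentiableAt (by simp)).hasFDerivAt
    simpa [mulLeftRight_apply] using this
  have h1 := (hd.comp (1 : U →L[ℂ] U) (mulLeftRight (g : U →L[ℂ] U)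
    ((g⁻¹ : GLin U) : U →L[ℂ] U)).hasFDerivAt).fderiv
  simp only [Function.comp_def, mulLeftRight_apply] at h1
  rw [h1] at h0
  exact h0

/-- `Dρ_g(a A b) = Dρ(A)` translated accordingly, for `A ∈ 𝔤` and `a b = g`. -/
theorem RationalRep.fderiv_translate (ρ : RationalRep G V) (a b : G) {A : U →L[ℂ] U}
    (hA : A ∈ lieAlgebra G) :
    fderiv ℂ ρ.ext ((a * b : G) : GLin U)
      (((a : GLin U) : U →L[ℂ] U) * A * ((b : GLin U) : U →L[ℂ] U)) =
    (ρ.toHom a : V →L[ℂ] V) * ρ.differential A * (ρ.toHom b : V →L[ℂ] V) := by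
  have key := fderiv_eq_of_regular (ρ.ext_regular.translate (a : GLin U) (b : GLin U))
    (ρ.ext_regular.mul (ρ.toHom a : V →L[ℂ] V) (ρ.toHom b : V →L[ℂ] V))
    (fun g hg => by
      have h1 := ρ.ext_apply (a * ⟨g, hg⟩ * b)
      have h2 := ρ.ext_apply ⟨g, hg⟩
      simp only [Subgroup.coe_mul, Units.val_mul, map_mul] at h1 h2
      rw [h1, h2]) hA
  have hd : HasFDerivAt ρ.ext (fderiv ℂ ρ.ext ((a * b : G) : GLin U))
      (mulLeftRight ((a : GLin U) : U →L[ℂ] U) ((b : GLin U) : U →L[ℂ] U) 1) := by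
    have := ((ρ.ext_regular.contDiffAt ((a * b : G) : GLin U)).differentiableAt
      (by simp)).hasFDerivAt
    simpa [mulLeftRight_apply] using this
  have h1 := (hd.comp (1 : U →L[ℂ] U) (mulLeftRight ((a : GLin U) : U →L[ℂ] U)
    ((b : GLin U) : U →L[ℂ] U)).hasFDerivAt).fderiv
  have hd1 : HasFDerivAt ρ.ext ρ.differential 1 :=
    ((ρ.ext_regular.contDiffAt 1).differentiableAt (by simp)).hasFDerivAt
  have h2 := ((mulLeftRight (ρ.toHom a : V →L[ℂ] V)
    (ρ.toHom b : V →L[ℂ] V)).hasFDerivAt.comp (1 : U →L[ℂ] U) hd1).fderiv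
  simp only [Function.comp_def, mulLeftRight_apply] at h1 h2
  rw [h1, h2] at key
  exact key

theorem RationalRep.differential_conj (ρ : RationalRep G V) (g : G) {A : U →L[ℂ] U}
    (hA : A ∈ lieAlgebra G) :
    ρ.differential (((g : GLin U) : U →L[ℂ] U) * A * (((g : GLin U)⁻¹ : GLin U) : U →L[ℂ] U)) =
    (ρ.toHom g : V →L[ℂ] V) * ρ.differential A * (((ρ.toHom g)⁻¹ : GLin V) : V →L[ℂ] V) := by
  have := ρ.fderiv_translate g g⁻¹ hA
  simpa [RationalRep.differential] using this

variable {X : Type*} [TopologicalSpace X] [ChartedSpace ℂ X] {ι : Type*}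

variable {K : Subgroup (GLin U)}

/-- The vector bundle `W = E_K(V)` associated to a principal `K`-bundle (`K ⊆ G`) through a
representation `ρ` of `G`. -/
def PrincipalBundle.associated (E : PrincipalBundle ι X K) (hKG : K ≤ G) (ρ : RationalRep G V) :
    Cocycle ι X V where
  base := E.base
  isOpen_base := E.isOpen_base
  cover := E.cover
  g i j x := ρ.toHom ⟨E.g i j x, hKG (E.mem i j x)⟩
  smooth i j := by
    intro x hx
    have h1 : ContDiffAt ℝ ∞ ρ.ext (E.g i j x : U →L[ℂ] U) :=
      (ρ.ext_regular.contDiffAt (E.g i j x)).restrict_scalars ℝ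
    have h2 := h1.contMDiffAt.comp_contMDiffWithinAt x (E.smooth i j x hx)
    refine h2.congr (fun y _ => ?_) ?_
    · exact (ρ.ext_apply ⟨E.g i j y, hKG (E.mem i j y)⟩).symm
    · exact (ρ.ext_apply ⟨E.g i j x, hKG (E.mem i j x)⟩).symm
  cocycle i j k x hx := by
    rw [← map_mul]
    congr 1
    exact Subtype.ext (E.cocycle i j k x hx)

/-- The map `A^{p,q}(ad E_G) → A^{p,q}(End W)` defined by the homomorphism `𝔤 → End V`. -/
def AdForm.push {σ : ℂ →+* ℂ} (E : PrincipalBundle ι X K) (hKG : K ≤ G) (ρ : RationalRep G V)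
    (a : AdForm σ E.toCocycle (lieAlgebra G)) : AdForm σ (E.associated hKG ρ) ⊤ where
  val i x := ρ.differential.comp (a.val i x)
  mem _ _ _ := trivial
  off i x h := by
    rw [a.off i x h]
    exact ContinuousLinearMap.comp_zero _
  equivariant i j x h v := by
    have := ρ.differential_conj ⟨E.g i j x, hKG (E.mem i j x)⟩ (a.mem j x v)
    simp only [ContinuousLinearMap.comp_apply]
    rw [a.equivariant i j x h v]
    exact this
  smooth i e he :=
    (ρ.differential.restrictScalars ℝ).contDiff.comp_contDiffOn (a.smooth i e he)

/-- The holomorphic structure on `W = E_G(V)` defined by a holomorphic structure on `E_G`. -/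
def HolStructure.push (E : PrincipalBundle ι X K) (hKG : K ≤ G) (ρ : RationalRep G V)
    (D : HolStructure E.toCocycle (lieAlgebra G)) : HolStructure (E.associated hKG ρ) ⊤ where
  val i x := ρ.differential.comp (D.val i x)
  mem _ _ _ := trivial
  off i x h := by
    rw [D.off i x h]
    exact ContinuousLinearMap.comp_zero _
  gauge i j x h v := by
    have hg := hKG (E.mem i j x)
    have hD := D.gauge i j x h v
    set B := dbar (fun y => (E.g i j y : U →L[ℂ] U)) x v with hB
    have hBmem : B * ((E.g i j x)⁻¹ : GLin U) ∈ lieAlgebra G := by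
      have h1 := (lieAlgebra G).sub_mem (conj_mem_lieAlgebra hg (D.mem j x v)) (D.mem i x v)
      rw [hD, sub_sub_cancel] at h1
      exact h1
    have h2 := ρ.differential_conj ⟨E.g i j x, hg⟩ (D.mem j x v)
    have h3 := ρ.fderiv_translate 1 ⟨E.g i j x, hg⟩ hBmem
    have hf : MDifferentiableAt 𝓘(ℝ, ℂ) 𝓘(ℝ, U →L[ℂ] U)
        (fun y => (E.g i j y : U →L[ℂ] U)) x :=
      ((E.smooth i j).contMDiffAt (((E.isOpen_base i).inter (E.isOpen_base j)).mem_nhds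
        h)).mdifferentiableAt (by simp)
    have h4 := dbar_comp (R := ρ.ext) hf
      ((ρ.ext_regular.contDiffAt (E.g i j x)).differentiableAt (by simp)) v
    have h5 : (fun y => ρ.ext (E.g i j y : U →L[ℂ] U)) =
        fun y => ((E.associated hKG ρ).g i j y : V →L[ℂ] V) := by
      funext y
      exact ρ.ext_apply ⟨E.g i j y, hKG (E.mem i j y)⟩
    rw [h5, ← hB] at h4
    have h6 : fderiv ℂ ρ.ext (E.g i j x : U →L[ℂ] U) B =
        ρ.differential (B * ((E.g i j x)⁻¹ : GLin U)) *
          ((E.associated hKG ρ).g i j x : V →L[ℂ] V) := by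
      simpa [mul_assoc, PrincipalBundle.associated] using h3
    simp only [ContinuousLinearMap.comp_apply]
    rw [hD, map_sub, h4, h6, mul_assoc (ρ.differential (B * ((E.g i j x)⁻¹ : GLin U))),
      Units.mul_inv, mul_one]
    exact congrArg (· - _) h2
  smooth i e he :=
    (ρ.differential.restrictScalars ℝ).contDiff.comp_contDiffOn (D.smooth i e he)

/-- The map `φ : 𝓑₀ → 𝓑_W`, which sends `(∂̄, θ)` to `(∂̄_W, θ_W)`. -/
def higgsEmbedding (E : PrincipalBundle ι X K) (hKG : K ≤ G) (ρ : RationalRep G V)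
    (p : HiggsSpace E.toCocycle (lieAlgebra G)) : HiggsSpace (E.associated hKG ρ) ⊤ :=
  ⟨p.dbar.push E hKG ρ, p.higgs.push E hKG ρ⟩

end Embedding

/-! ## The Kähler structure on the space of pairs -/

section Kaehler

variable {U : Type*} [NormedAddCommGroup U] [NormedSpace ℂ U]
variable {V : Type*} [NormedAddCommGroup V] [NormedSpace ℂ V]

open Classical in
/-- The components `(A₁, A₂)` of `A = A₁ + √-1 A₂`, for `A ∈ 𝔨 ⊕ √-1 𝔨`. -/
def components (𝔨 : Set (U →L[ℂ] U)) (A : U →L[ℂ] U) : (U →L[ℂ] U) × (U →L[ℂ] U) :=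
  if h : ∃ p : (U →L[ℂ] U) × (U →L[ℂ] U), p.1 ∈ 𝔨 ∧ p.2 ∈ 𝔨 ∧ A = p.1 + Complex.I • p.2
  then h.choose else 0

/-- The Hermitian form on `𝔨 ⊕ √-1 𝔨` (complex linear in the first variable) which extends a
symmetric bilinear form `b` on `𝔨`. -/
def hermitianExtension (𝔨 : Set (U →L[ℂ] U)) (b : (U →L[ℂ] U) → (U →L[ℂ] U) → ℂ)
    (A B : U →L[ℂ] U) : ℂ :=
  b (components 𝔨 A).1 (components 𝔨 B).1 + b (components 𝔨 A).2 (components 𝔨 B).2 +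
    Complex.I *
      (b (components 𝔨 A).2 (components 𝔨 B).1 - b (components 𝔨 A).1 (components 𝔨 B).2)

/-- `⟨A, B⟩ = -trace (A B)`. -/
def negTrace (A B : V →L[ℂ] V) : ℂ :=
  -LinearMap.trace ℂ V ((A * B : V →L[ℂ] V) : V →ₗ[ℂ] V)

/-- The Hermitian inner product on `End V = 𝔨 ⊕ √-1 𝔨` defined by `-trace (A B)` on the Lie algebra
`𝔨` of a maximal compact subgroup `K` of `GL(V)`. -/
def innerEnd (K : Subgroup (GLin V)) : (V →L[ℂ] V) → (V →L[ℂ] V) → ℂ :=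
  hermitianExtension (realLieAlgebra K) negTrace

/-- The Hermitian inner product on `𝔤 = 𝔨 ⊕ √-1 𝔨` defined by the restriction of `-trace (A B)` to
the Lie algebra `𝔨` of `K`, which is mapped to `End V` by the differential of `ρ`. -/
def innerLie {G : Subgroup (GLin U)} (K : Subgroup (GLin U)) (ρ : RationalRep G V) :
    (U →L[ℂ] U) → (U →L[ℂ] U) → ℂ :=
  hermitianExtension (realLieAlgebra K)
    fun A B => negTrace (ρ.differential A) (ρ.differential B)

variable {X : Type*} [TopologicalSpace X] [ChartedSpace ℂ X] {ι : Type*}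
variable {c : Cocycle ι X U} {𝔤 : Submodule ℂ (U →L[ℂ] U)}

/-- The complex valued 2-form `⟨a, b̄⟩`, for forms `a`, `b` with values in the adjoint bundle and the
inner product on its fibres given by an inner product `h` that is invariant under the transition
functions (so that the choice of a local frame at each point is immaterial):
`⟨a, b̄⟩(v, w) = h(a v, b w) - h(a w, b v)`. -/
def wedgeConj {σ : ℂ →+* ℂ} (h : (U →L[ℂ] U) → (U →L[ℂ] U) → ℂ) (a b : AdForm σ c 𝔤) (x : X)
    (v w : TangentSpace 𝓘(ℂ, ℂ) x) : ℂ :=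
  h (a.val (c.cover x).choose x v) (b.val (c.cover x).choose x w) -
    h (a.val (c.cover x).choose x w) (b.val (c.cover x).choose x v)

variable [T2Space X] [CompactSpace X]

/-- The Hermitian inner product on `A^{0,1}(ad) ⊕ A^{1,0}(ad)` with
`‖(ω₀₁, ω₁₀)‖² = √-1 ∫_X ⟨ω₁₀, ω̄₁₀⟩ - √-1 ∫_X ⟨ω₀₁, ω̄₀₁⟩`. -/
def hermitianProduct (h : (U →L[ℂ] U) → (U →L[ℂ] U) → ℂ) (u v : HiggsTangent c 𝔤) : ℂ :=
  Complex.I * integral2 (wedgeConj h u.2 v.2) - Complex.I * integral2 (wedgeConj h u.1 v.1)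

/-- The (translation invariant) Riemannian metric on `𝓑`. -/
def riemannianMetric (h : (U →L[ℂ] U) → (U →L[ℂ] U) → ℂ) (_p : HiggsSpace c 𝔤)
    (u v : HiggsTangent c 𝔤) : ℝ :=
  (hermitianProduct h u v).re

/-- The Kähler form `Ω(u, v) = g(√-1 u, v)` on `𝓑`. -/
def kaehlerForm (h : (U →L[ℂ] U) → (U →L[ℂ] U) → ℂ) (p : HiggsSpace c 𝔤)
    (u v : HiggsTangent c 𝔤) : ℝ :=
  riemannianMetric h p (Complex.I • u) v

end Kaehler

/-! ## Riemannian geometry of affine spaces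

`P` is a (possibly infinite dimensional) affine space with translation space `E`, which is also its
tangent space at every point; likewise `Q` and `F`. Derivatives are derivatives along lines. -/

section Geometry

variable {E P F Q : Type*}
variable [AddCommGroup E] [Module ℝ E] [TopologicalSpace E] [AddAction E P] [VSub E P]
variable [AddCommGroup F] [Module ℝ F] [TopologicalSpace F] [AddAction F Q] [VSub F Q]

/-- The curve `c` has velocity `w` at time `t`. -/
def HasVelocity (c : ℝ → P) (w : E) (t : ℝ) : Prop :=
  Filter.Tendsto (fun s : ℝ => s⁻¹ • (c (t + s) -ᵥ c t)) (𝓝[≠] 0) (𝓝 w)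

/-- `df p u` is the derivative of `f` at `p` in the direction of the tangent vector `u`. -/
def IsDifferential (f : P → Q) (df : P → E → F) : Prop :=
  ∀ (p : P) (u : E), HasVelocity (fun t : ℝ => f (t • u +ᵥ p)) (df p u) 0

/-- `Γ` is the Levi-Civita connection of the metric `g`, that is
`(∇_u Y)(p) = (D_u Y)(p) + Γ p u (Y p)` is torsion free and compatible with `g`. -/
structure IsLeviCivita (g : P → E → E → ℝ) (Γ : P → E →ₗ[ℝ] E →ₗ[ℝ] E) : Prop where
  torsionFree : ∀ p u v, Γ p u v = Γ p v u
  metric : ∀ p u v w, HasDerivAt (fun t : ℝ => g (t • u +ᵥ p) v w)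
    (g p (Γ p u v) w + g p v (Γ p u w)) 0

/-- The Levi-Civita connection of a translation invariant metric exists: it is the flat one. -/
theorem isLeviCivita_zero {g : P → E → E → ℝ} (hg : ∀ p q u v, g p u v = g q u v)
    (h0 : ∀ p u, g p 0 u = 0 ∧ g p u 0 = 0) : IsLeviCivita g 0 where
  torsionFree _ _ _ := rfl
  metric p u v w := by
    have h : (fun t : ℝ => g (t • u +ᵥ p) v w) = fun _ => g p v w := funext fun t => hg _ _ v w
    rw [h]
    simpa [h0] using hasDerivAt_const (0 : ℝ) (g p v w)

/-- `II` is the second fundamental form of the immersion `f : P → Q`, with differential `df`, for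
the metric `g` on `Q` with Levi-Civita connection `Γ`: for tangent vectors `u`, `v` of `P`, extended
to constant vector fields, `II p u v` is the component of `∇_u (df v)` that is normal to the image
of `df p`. -/
def IsSecondFundamentalForm (g : Q → F → F → ℝ) (Γ : Q → F →ₗ[ℝ] F →ₗ[ℝ] F) (f : P → Q)
    (df : P → E → F) (II : P → E → E → F) : Prop :=
  ∀ (p : P) (u v : E),
    (∀ w : E, g (f p) (II p u v) (df p w) = 0) ∧
    ∃ D : F, HasVelocity (fun t : ℝ => df (t • u +ᵥ p) v) D 0 ∧
      ∃ w : E, D + Γ (f p) (df p u) (df p v) = df p w + II p u v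

/-- `c` is a geodesic, for the connection `Γ`, on the set `J` of times. -/
def IsGeodesicOn (Γ : P → E →ₗ[ℝ] E →ₗ[ℝ] E) (c : ℝ → P) (J : Set ℝ) : Prop :=
  ∃ c' c'' : ℝ → E, ∀ t ∈ J, HasVelocity c (c' t) t ∧ HasVelocity c' (c'' t) t ∧
    c'' t + Γ (c t) (c' t) (c' t) = 0

/-- `f` maps geodesics to geodesics. -/
def IsTotallyGeodesic (ΓP : P → E →ₗ[ℝ] E →ₗ[ℝ] E) (ΓQ : Q → F →ₗ[ℝ] F →ₗ[ℝ] F)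
    (f : P → Q) : Prop :=
  ∀ (c : ℝ → P) (a b : ℝ), IsGeodesicOn ΓP c (Set.Ioo a b) → IsGeodesicOn ΓQ (f ∘ c) (Set.Ioo a b)

end Geometry

end PrincipalHiggs

end

/-! The map `φ` is affine. In local frames a holomorphic structure is a Lie algebra valued form, and
`φ` applies the constant linear map `dρ` to it, so differences are sent to differences by one
continuous complex linear map, `pushTangent` (`higgsEmbedding_vsub`). The theorem therefore reduces
to three facts.

Isometry: `dρ` carries `𝔨` into `Lie(K')` and is complex linear, hence respects the decompositions
`A₁ + √-1 A₂` on both sides and the Hermitian extensions of the trace forms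
(`RationalRep.innerEnd_differential`). Integrating over `X` shows that `pushTangent` preserves the
metrics, and being complex linear it preserves the Kähler forms.

Definiteness: averaging over `K'` gives coordinates in which `K'` is unitary; maximality makes
`Lie(K')` the skew-Hermitian operators, so `innerEnd K'` is `trace (A B*)`
(`innerEnd_eq_traceInner`). The `L²` metric on `𝓑_W` is then definite, because a continuous
nonnegative density with zero integral vanishes. As `ρ` is faithful, `dρ` is injective on `𝔤`
(`RationalRep.differential_injOn`), which makes `φ` injective and transfers definiteness to `𝓑₀`.

Flatness: a symmetric definite translation invariant metric has only the flat Levi-Civita connection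
(`IsLeviCivita.eq_zero`). The field `dφ(v)` is constant, so its covariant derivative is zero, and a
second fundamental form is at once tangent and normal to the image, hence zero. Geodesics are the
curves with zero acceleration, which `φ` preserves. -/

noncomputable section

namespace PrincipalHiggs

/-! ### Compact groups of operators and their Lie algebras -/

section CompactGroups

variable {V : Type*} [NormedAddCommGroup V] [NormedSpace ℂ V]

/-- The operators that are unitary in the coordinates `e`. -/
def unitarySubgroup {n : ℕ} (e : V ≃L[ℂ] EuclideanSpace ℂ (Fin n)) : Subgroup (GLin V) :=
  ((Units.map (e.conjContinuousAlgEquiv.symm : (EuclideanSpace ℂ (Fin n) →L[ℂ]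
    EuclideanSpace ℂ (Fin n)) →* (V →L[ℂ] V))).comp Unitary.toUnits).range

theorem mem_unitarySubgroup {n : ℕ} {e : V ≃L[ℂ] EuclideanSpace ℂ (Fin n)} {k : GLin V} :
    k ∈ unitarySubgroup e ↔ e.conjContinuousAlgEquiv (k : V →L[ℂ] V) ∈
      unitary (EuclideanSpace ℂ (Fin n) →L[ℂ] EuclideanSpace ℂ (Fin n)) := by
  constructor
  · rintro ⟨u, rfl⟩
    have h : e.conjContinuousAlgEquiv (e.conjContinuousAlgEquiv.symm
        (u : EuclideanSpace ℂ (Fin n) →L[ℂ] EuclideanSpace ℂ (Fin n))) = u :=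
      e.conjContinuousAlgEquiv.apply_symm_apply _
    exact h ▸ u.2
  · exact fun h => ⟨⟨_, h⟩, Units.ext (e.conjContinuousAlgEquiv.symm_apply_apply _)⟩

-- Unitary operators form a closed subset of the unit ball of a finite-dimensional space. The
-- topology of `GL(V)` also records inverses, so continuity of `star` is needed to transport
-- compactness.
set_option maxSynthPendingDepth 3 in
theorem isCompact_unitarySubgroup {n : ℕ} (e : V ≃L[ℂ] EuclideanSpace ℂ (Fin n)) :
    IsCompact (unitarySubgroup e : Set (GLin V)) := by
  have : ProperSpace (EuclideanSpace ℂ (Fin n) →L[ℂ] EuclideanSpace ℂ (Fin n)) :=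
    FiniteDimensional.proper ℂ _
  have h1 : IsCompact (unitary (EuclideanSpace ℂ (Fin n) →L[ℂ] EuclideanSpace ℂ (Fin n)) :
      Set (EuclideanSpace ℂ (Fin n) →L[ℂ] EuclideanSpace ℂ (Fin n))) := by
    refine Metric.isCompact_of_isClosed_isBounded isClosed_unitary ?_
    refine (Metric.isBounded_closedBall (x := 0) (r := 1)).subset fun M hM => ?_
    rw [mem_closedBall_zero_iff]
    refine M.opNorm_le_bound zero_le_one fun x => ?_
    rw [one_mul]
    exact (Unitary.norm_map ⟨M, hM⟩ x).le
  have := isCompact_iff_compactSpace.1 h1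
  refine isCompact_range (Units.continuous_iff.2 ⟨?_, ?_⟩)
  · exact e.conjContinuousAlgEquiv.symm.continuous.comp continuous_subtype_val
  · exact e.conjContinuousAlgEquiv.symm.continuous.comp
      (continuous_star.comp continuous_subtype_val)

variable [FiniteDimensional ℂ V]

/-- `W` carries no norm and `e` no continuity, so that the norm of `core` does not clash with the
one already given on `V`. -/
theorem exists_orthonormal_coordinates {W : Type*} [AddCommGroup W] [Module ℂ W]
    [FiniteDimensional ℂ W] (core : InnerProductSpace.Core ℂ W) :
    ∃ (n : ℕ) (e : W ≃ₗ[ℂ] EuclideanSpace ℂ (Fin n)),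
      ∀ x y, inner ℂ (e x) (e y) = core.inner x y := by
  let _ : NormedAddCommGroup W := core.toNormedAddCommGroup
  let _ : InnerProductSpace ℂ W := InnerProductSpace.ofCore core.toCore
  exact ⟨_, (stdOrthonormalBasis ℂ W).repr.toLinearEquiv,
    fun x y => (stdOrthonormalBasis ℂ W).repr.inner_map_map x y⟩

open MeasureTheory in
/-- A compact group of operators preserves a Hermitian inner product. -/
theorem exists_unitary_coordinates {K : Subgroup (GLin V)}
    (hK : IsCompact (K : Set (GLin V))) :
    ∃ (n : ℕ) (e : V ≃L[ℂ] EuclideanSpace ℂ (Fin n)),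
      ∀ k ∈ K, e.conjContinuousAlgEquiv (k : V →L[ℂ] V) ∈
        unitary (EuclideanSpace ℂ (Fin n) →L[ℂ] EuclideanSpace ℂ (Fin n)) := by
  suffices h : ∃ (n : ℕ) (e : V ≃L[ℂ] EuclideanSpace ℂ (Fin n)),
      ∀ k ∈ K, ∀ x y, inner ℂ (e ((k : V →L[ℂ] V) x)) (e ((k : V →L[ℂ] V) y)) =
        inner ℂ (e x) (e y) by
    obtain ⟨n, e, he⟩ := h
    refine ⟨n, e, fun k hk => ?_⟩
    have h1 : star (e.conjContinuousAlgEquiv (k : V →L[ℂ] V)) *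
        e.conjContinuousAlgEquiv (k : V →L[ℂ] V) = 1 := by
      ext1 x
      refine ext_inner_left ℂ fun y => ?_
      rw [ContinuousLinearMap.star_eq_adjoint, mul_apply_eq_comp,
        ContinuousLinearMap.adjoint_inner_right]
      simpa using he k hk (e.symm y) (e.symm x)
    -- For an invertible operator a left inverse is two-sided.
    have h2 : IsUnit (e.conjContinuousAlgEquiv (k : V →L[ℂ] V)) := k.isUnit.map _
    obtain ⟨u, hu⟩ := h2
    rw [Unitary.mem_iff]
    rw [← hu] at h1 ⊢
    exact ⟨h1, by rw [Units.mul_eq_one_iff_eq_inv.1 h1, Units.mul_inv]⟩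
  have : CompactSpace K := isCompact_iff_compactSpace.1 hK
  let _ : MeasurableSpace K := borel K
  have : BorelSpace K := ⟨rfl⟩
  let μ : Measure K := Measure.haar
  obtain ⟨e₀⟩ : Nonempty (V ≃L[ℂ] EuclideanSpace ℂ (Fin (Module.finrank ℂ V))) :=
    ⟨ContinuousLinearEquiv.ofFinrankEq (by simp)⟩
  -- The inverse is chosen to match left invariance of Haar measure: `F (k x) (k l) = F x l`.
  let F : V → K → EuclideanSpace ℂ (Fin (Module.finrank ℂ V)) :=
    fun x k => e₀ ((((k⁻¹ : K) : GLin V) : V →L[ℂ] V) x)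
  have hF : ∀ x, Continuous (F x) := by
    intro x
    have h1 : Continuous fun k : K => ((((k⁻¹ : K) : GLin V) : V →L[ℂ] V)) :=
      Units.continuous_val.comp (continuous_subtype_val.comp continuous_inv)
    exact e₀.continuous.comp (h1.clm_apply continuous_const)
  have hint : ∀ x y, Integrable (fun k => inner ℂ (F x k) (F y k)) μ := fun x y =>
    ((hF x).inner (hF y)).integrable_of_hasCompactSupport (HasCompactSupport.of_compactSpace _)
  let core : InnerProductSpace.Core ℂ V :=
    { inner := fun x y => ∫ k, inner ℂ (F x k) (F y k) ∂μ
      conj_inner_symm := fun x y => by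
        rw [← integral_conj]
        simp only [inner_conj_symm]
      re_inner_nonneg := fun x => by
        rw [← integral_re (hint x x)]
        exact integral_nonneg fun k => inner_self_nonneg
      add_left := fun x y z => by
        rw [← integral_add (hint x z) (hint y z)]
        simp only [F, map_add, inner_add_left]
      smul_left := fun x y r => by
        rw [← integral_const_mul]
        simp only [F, map_smul, inner_smul_left]
      definite := fun x hx => by
        by_contra hne
        -- The integrand is continuous, nonnegative, and positive at the identity, where it is `‖e₀
        -- x‖²`.
        have hpos : 0 < ∫ k, RCLike.re (inner ℂ (F x k) (F x k)) ∂μ := by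
          refine Continuous.integral_pos_of_hasCompactSupport_nonneg_nonzero (x := 1)
            (RCLike.continuous_re.comp ((hF x).inner (hF x)))
            (HasCompactSupport.of_compactSpace _) (fun k => inner_self_nonneg) ?_
          simp [F, hne, ← Complex.ofReal_pow]
        rw [integral_re (hint x x)] at hpos
        have hx' : ∫ k, inner ℂ (F x k) (F x k) ∂μ = 0 := hx
        rw [hx'] at hpos
        simp at hpos }
  obtain ⟨n, e, he⟩ := exists_orthonormal_coordinates core
  refine ⟨n, e.toContinuousLinearEquiv, fun k hk x y => ?_⟩
  have h := integral_mul_left_eq_self (μ := μ)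
    (fun l => inner ℂ (F ((k : V →L[ℂ] V) x) l) (F ((k : V →L[ℂ] V) y) l)) ⟨k, hk⟩
  have h2 : ∀ (l : K) (z : V), F ((k : V →L[ℂ] V) z) (⟨k, hk⟩ * l) = F z l := by
    intro l z
    simp only [F, mul_inv_rev, Subgroup.coe_mul, Units.val_mul, Subgroup.coe_inv]
    have : (((k⁻¹ : GLin V) : V →L[ℂ] V)) ((k : V →L[ℂ] V) z) = z := by
      rw [← mul_apply_eq_comp, Units.inv_mul, one_apply_eq_self]
    simp [this]
  simp only [h2] at h
  exact (he _ _).trans (h.symm.trans (he _ _).symm)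


-- Differentiate `exp(tB)* exp(tB) = 1` at `t = 0`.
set_option maxSynthPendingDepth 3 in
theorem conj_realLieAlgebra_mem_skewAdjoint {K : Subgroup (GLin V)} {n : ℕ}
    {e : V ≃L[ℂ] EuclideanSpace ℂ (Fin n)}
    (he : ∀ k ∈ K, e.conjContinuousAlgEquiv (k : V →L[ℂ] V) ∈
        unitary (EuclideanSpace ℂ (Fin n) →L[ℂ] EuclideanSpace ℂ (Fin n)))
    {A : V →L[ℂ] V} (hA : A ∈ realLieAlgebra K) :
    star (e.conjContinuousAlgEquiv A) = -e.conjContinuousAlgEquiv A := by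
  have : CompleteSpace V := FiniteDimensional.complete ℂ V
  let _ : NormedAlgebra ℚ (V →L[ℂ] V) := .restrictScalars ℚ ℂ _
  let _ : NormedAlgebra ℚ (EuclideanSpace ℂ (Fin n) →L[ℂ] EuclideanSpace ℂ (Fin n)) :=
    .restrictScalars ℚ ℂ _
  set B := e.conjContinuousAlgEquiv A with hB
  have h1 : ∀ t : ℝ, NormedSpace.exp (t • star B) * NormedSpace.exp (t • B) = 1 := by
    intro t
    obtain ⟨k, hk, hkt⟩ := hA t
    have h2 : NormedSpace.exp (t • B) = e.conjContinuousAlgEquiv (k : V →L[ℂ] V) := by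
      rw [hkt, NormedSpace.map_exp _ e.conjContinuousAlgEquiv.continuous]
      congr 1
      exact (map_smul e.conjContinuousAlgEquiv (t : ℂ) A).symm
    have h3 : NormedSpace.exp (t • star B) = star (NormedSpace.exp (t • B)) := by
      rw [NormedSpace.star_exp, ← Complex.coe_smul t B, star_smul, Complex.star_def,
        Complex.conj_ofReal, Complex.coe_smul]
    rw [h3, h2]
    exact (Unitary.mem_iff.1 (he k hk)).1
  have h2 := (hasDerivAt_exp_smul_const (𝕂 := ℝ) (star B) (0 : ℝ)).mul
    (hasDerivAt_exp_smul_const (𝕂 := ℝ) B (0 : ℝ))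
  have h3 := h2.unique ((hasDerivAt_const (0 : ℝ)
    (1 : EuclideanSpace ℂ (Fin n) →L[ℂ] EuclideanSpace ℂ (Fin n))).congr_of_eventuallyEq
      (Filter.Eventually.of_forall h1))
  simp only [zero_smul, NormedSpace.exp_zero, one_mul, mul_one] at h3
  exact eq_neg_of_add_eq_zero_left h3

set_option maxSynthPendingDepth 3 in
/-- The Lie algebra of a maximal compact subgroup of `GL(V)` consists of the operators that are
skew-Hermitian in suitable coordinates. -/
theorem mem_realLieAlgebra_iff_of_isMaximalCompact {K : Subgroup (GLin V)}
    (hK : IsMaximalCompact K ⊤) {n : ℕ} {e : V ≃L[ℂ] EuclideanSpace ℂ (Fin n)}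
    (he : ∀ k ∈ K, e.conjContinuousAlgEquiv (k : V →L[ℂ] V) ∈
        unitary (EuclideanSpace ℂ (Fin n) →L[ℂ] EuclideanSpace ℂ (Fin n)))
    {A : V →L[ℂ] V} :
    A ∈ realLieAlgebra K ↔ star (e.conjContinuousAlgEquiv A) = -e.conjContinuousAlgEquiv A := by
  refine ⟨conj_realLieAlgebra_mem_skewAdjoint he, fun h t => ?_⟩
  have : CompleteSpace V := FiniteDimensional.complete ℂ V
  let _ : NormedAlgebra ℚ (V →L[ℂ] V) := .restrictScalars ℚ ℂ _
  let _ : NormedAlgebra ℚ (EuclideanSpace ℂ (Fin n) →L[ℂ] EuclideanSpace ℂ (Fin n)) :=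
    .restrictScalars ℚ ℂ _
  have hu : IsUnit (NormedSpace.exp (t • A)) := NormedSpace.isUnit_exp _
  obtain ⟨k, hk⟩ := hu
  refine ⟨k, ?_, hk⟩
  -- By maximality `K` is the whole unitary group, so exponentials of skew-Hermitian operators lie
  -- in it.
  rw [← hK.maximal (unitarySubgroup e) le_top (isCompact_unitarySubgroup e)
      fun g hg => mem_unitarySubgroup.2 (he g hg),
    mem_unitarySubgroup, hk, NormedSpace.map_exp _ e.conjContinuousAlgEquiv.continuous]
  refine NormedSpace.exp_mem_unitary_of_mem_skewAdjoint ?_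
  rw [skewAdjoint.mem_iff, ← Complex.coe_smul, map_smul, star_smul, h, Complex.star_def,
    Complex.conj_ofReal, smul_neg]

end CompactGroups

/-! ### The trace form and its Hermitian extension -/

section HermitianForms

set_option maxSynthPendingDepth 3

variable {V : Type*} [NormedAddCommGroup V] [NormedSpace ℂ V]

/-- `h` is a continuous Hermitian inner product on `End V`. -/
structure IsHermitianInner (h : (V →L[ℂ] V) → (V →L[ℂ] V) → ℂ) : Prop where
  add_left : ∀ A B C, h (A + B) C = h A C + h B C
  smul_left : ∀ (z : ℂ) A B, h (z • A) B = z * h A B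
  conj_symm : ∀ A B, starRingEnd ℂ (h B A) = h A B
  nonneg : ∀ A, 0 ≤ (h A A).re
  definite : ∀ A, (h A A).re = 0 → A = 0
  continuous : Continuous fun A => (h A A).re

namespace IsHermitianInner

variable {h : (V →L[ℂ] V) → (V →L[ℂ] V) → ℂ} (hh : IsHermitianInner h)
include hh

theorem add_right (A B C : V →L[ℂ] V) : h A (B + C) = h A B + h A C := by
  rw [← hh.conj_symm, hh.add_left, map_add, hh.conj_symm, hh.conj_symm]

theorem smul_right (z : ℂ) (A B : V →L[ℂ] V) : h A (z • B) = starRingEnd ℂ z * h A B := by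
  rw [← hh.conj_symm, hh.smul_left, map_mul, hh.conj_symm]

theorem zero_left (A : V →L[ℂ] V) : h 0 A = 0 := by
  simpa using hh.smul_left 0 0 A

theorem ofReal_re (A : V →L[ℂ] V) : ((h A A).re : ℂ) = h A A :=
  Complex.conj_eq_iff_re.1 (hh.conj_symm A A)

end IsHermitianInner

/-- The Hermitian inner product `trace (A B*)`, for the adjoint `B*` of `B` with respect to the
coordinates `e`. -/
def traceInner {n : ℕ} (e : V ≃L[ℂ] EuclideanSpace ℂ (Fin n)) (A B : V →L[ℂ] V) : ℂ :=
  LinearMap.trace ℂ (EuclideanSpace ℂ (Fin n))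
    ((e.conjContinuousAlgEquiv A * star (e.conjContinuousAlgEquiv B) :
      EuclideanSpace ℂ (Fin n) →L[ℂ] EuclideanSpace ℂ (Fin n)) :
      EuclideanSpace ℂ (Fin n) →ₗ[ℂ] EuclideanSpace ℂ (Fin n))

/-- By cyclicity of the trace this is the sum of the inner products of columns, from which
positivity and definiteness can be read off. -/
theorem traceInner_eq_sum {n : ℕ} (e : V ≃L[ℂ] EuclideanSpace ℂ (Fin n)) (A B : V →L[ℂ] V) :
    traceInner e A B = ∑ i, inner ℂ
      (e.conjContinuousAlgEquiv B (EuclideanSpace.single i 1))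
      (e.conjContinuousAlgEquiv A (EuclideanSpace.single i 1)) := by
  have h := LinearMap.trace_mul_comm ℂ
    (e.conjContinuousAlgEquiv A : EuclideanSpace ℂ (Fin n) →ₗ[ℂ] EuclideanSpace ℂ (Fin n))
    (star (e.conjContinuousAlgEquiv B) : EuclideanSpace ℂ (Fin n) →L[ℂ] EuclideanSpace ℂ (Fin n))
  refine h.trans ?_
  rw [LinearMap.trace_eq_sum_inner _ (EuclideanSpace.basisFun (Fin n) ℂ)]
  refine Finset.sum_congr rfl fun i _ => ?_
  simp [ContinuousLinearMap.star_eq_adjoint, ContinuousLinearMap.adjoint_inner_right]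

theorem isHermitianInner_traceInner {n : ℕ} (e : V ≃L[ℂ] EuclideanSpace ℂ (Fin n)) :
    IsHermitianInner (traceInner e) where
  add_left A B C := by
    simp only [traceInner_eq_sum, map_add, add_apply, inner_add_right, Finset.sum_add_distrib]
  smul_left z A B := by
    simp only [traceInner_eq_sum, map_smul, smul_apply, inner_smul_right, Finset.mul_sum]
  conj_symm A B := by
    simp only [traceInner_eq_sum, map_sum, inner_conj_symm]
  nonneg A := by
    rw [traceInner_eq_sum, Complex.re_sum]
    exact Finset.sum_nonneg fun i _ => inner_self_nonneg (𝕜 := ℂ)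
  definite A hA := by
    rw [traceInner_eq_sum, Complex.re_sum] at hA
    replace hA := (Finset.sum_eq_zero_iff_of_nonneg fun i _ =>
      inner_self_nonneg (𝕜 := ℂ)).1 hA
    have h : e.conjContinuousAlgEquiv A = 0 := by
      refine ContinuousLinearMap.coe_injective
        ((EuclideanSpace.basisFun (Fin n) ℂ).toBasis.ext fun i => ?_)
      simpa [← Complex.ofReal_pow] using hA i (Finset.mem_univ i)
    simpa using h
  continuous := by
    simp only [traceInner_eq_sum]
    have h : ∀ x, Continuous fun A => e.conjContinuousAlgEquiv A x := fun x =>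
      e.conjContinuousAlgEquiv.continuous.clm_apply continuous_const
    exact Complex.continuous_re.comp (continuous_finsetSum _ fun i _ => (h _).inner (h _))

theorem traceInner_conj {n : ℕ} {e : V ≃L[ℂ] EuclideanSpace ℂ (Fin n)} {k : GLin V}
    (hk : e.conjContinuousAlgEquiv (k : V →L[ℂ] V) ∈
      unitary (EuclideanSpace ℂ (Fin n) →L[ℂ] EuclideanSpace ℂ (Fin n))) (A B : V →L[ℂ] V) :
    traceInner e ((k : V →L[ℂ] V) * A * ((k⁻¹ : GLin V) : V →L[ℂ] V))
      ((k : V →L[ℂ] V) * B * ((k⁻¹ : GLin V) : V →L[ℂ] V)) = traceInner e A B := by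
  have h1 : e.conjContinuousAlgEquiv ((k⁻¹ : GLin V) : V →L[ℂ] V) =
      star (e.conjContinuousAlgEquiv (k : V →L[ℂ] V)) := by
    refine left_inv_eq_right_inv (a := e.conjContinuousAlgEquiv (k : V →L[ℂ] V)) ?_
      (Unitary.mem_iff.1 hk).2
    rw [← map_mul, Units.inv_mul, map_one]
  have h2 := (Unitary.mem_iff.1 hk).1
  unfold traceInner
  simp only [map_mul, h1, star_mul, star_star]
  generalize e.conjContinuousAlgEquiv (k : V →L[ℂ] V) = T at *
  generalize e.conjContinuousAlgEquiv A = A'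
  generalize e.conjContinuousAlgEquiv B = B'
  have h3 : T * A' * star T * (T * (star B' * star T)) = T * (A' * star B' * star T) := by
    calc _ = T * A' * (star T * T) * (star B' * star T) := by simp only [mul_assoc]
      _ = _ := by rw [h2]; simp only [mul_assoc, mul_one]
  rw [h3]
  refine (LinearMap.trace_mul_comm ℂ (T : EuclideanSpace ℂ (Fin n) →ₗ[ℂ] _)
    ((A' * star B' * star T : EuclideanSpace ℂ (Fin n) →L[ℂ] _) :
      EuclideanSpace ℂ (Fin n) →ₗ[ℂ] EuclideanSpace ℂ (Fin n))).trans ?_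
  have h4 : A' * star B' * star T * T = A' * star B' := by rw [mul_assoc, h2, mul_one]
  exact congrArg (fun S : EuclideanSpace ℂ (Fin n) →L[ℂ] EuclideanSpace ℂ (Fin n) =>
    LinearMap.trace ℂ (EuclideanSpace ℂ (Fin n)) S) h4

/-- `√-1` times a skew-Hermitian operator is Hermitian, and only zero is both. -/
theorem eq_zero_of_smul_I_skew {n : ℕ} {e : V ≃L[ℂ] EuclideanSpace ℂ (Fin n)} {A B : V →L[ℂ] V}
    (hA : star (e.conjContinuousAlgEquiv A) = -e.conjContinuousAlgEquiv A)
    (hB : star (e.conjContinuousAlgEquiv B) = -e.conjContinuousAlgEquiv B)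
    (h : A = Complex.I • B) : A = 0 := by
  have h1 : e.conjContinuousAlgEquiv A = Complex.I • e.conjContinuousAlgEquiv B := by
    rw [h, map_smul]
  have h2 : e.conjContinuousAlgEquiv A = -e.conjContinuousAlgEquiv A := by
    rw [← hA, h1, star_smul, hB]
    simp
  have h3 : (2 : ℂ) • e.conjContinuousAlgEquiv A = 0 := by
    rw [two_smul]
    exact add_eq_zero_iff_eq_neg.2 h2
  rw [smul_eq_zero, or_iff_right two_ne_zero] at h3
  exact (map_eq_zero_iff _ e.conjContinuousAlgEquiv.injective).1 h3

/-- Since `B* = -B`, the sign is absorbed by the adjoint; the trace does not depend on coordinates.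
-/
theorem negTrace_eq_traceInner {n : ℕ} {e : V ≃L[ℂ] EuclideanSpace ℂ (Fin n)} {A B : V →L[ℂ] V}
    (hB : star (e.conjContinuousAlgEquiv B) = -e.conjContinuousAlgEquiv B) :
    negTrace A B = traceInner e A B := by
  unfold traceInner negTrace
  have h := LinearMap.trace_conj' ((A * B : V →L[ℂ] V) : V →ₗ[ℂ] V) e.toLinearEquiv
  have h1 : e.conjContinuousAlgEquiv A * -e.conjContinuousAlgEquiv B =
      -e.conjContinuousAlgEquiv (A * B) := by rw [map_mul, mul_neg]
  rw [hB, h1, ← h, ContinuousLinearMap.toLinearMap_neg, map_neg]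
  rfl

variable [FiniteDimensional ℂ V]

/-- The decomposition of an element of `𝔨 ⊕ √-1 𝔨` is unique, for the Lie algebra `𝔨` of a compact
group. -/
theorem add_smul_I_injective {K : Subgroup (GLin V)} (hK : IsCompact (K : Set (GLin V)))
    {A₁ A₂ B₁ B₂ : V →L[ℂ] V} (hA₁ : A₁ ∈ realLieAlgebra K) (hA₂ : A₂ ∈ realLieAlgebra K)
    (hB₁ : B₁ ∈ realLieAlgebra K) (hB₂ : B₂ ∈ realLieAlgebra K)
    (h : A₁ + Complex.I • A₂ = B₁ + Complex.I • B₂) : A₁ = B₁ ∧ A₂ = B₂ := by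
  obtain ⟨n, e, he⟩ := exists_unitary_coordinates hK
  have hs : ∀ {A B : V →L[ℂ] V}, A ∈ realLieAlgebra K → B ∈ realLieAlgebra K →
      star (e.conjContinuousAlgEquiv (A - B)) = -e.conjContinuousAlgEquiv (A - B) := by
    intro A B hA hB
    rw [map_sub, ContinuousLinearMap.star_eq_adjoint, map_sub,
      ← ContinuousLinearMap.star_eq_adjoint, ← ContinuousLinearMap.star_eq_adjoint,
      conj_realLieAlgebra_mem_skewAdjoint he hA,
      conj_realLieAlgebra_mem_skewAdjoint he hB]
    abel
  have h1 : A₁ - B₁ = Complex.I • (B₂ - A₂) := by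
    rw [smul_sub, sub_eq_sub_iff_add_eq_add, h, add_comm]
  have h2 := eq_zero_of_smul_I_skew (hs hA₁ hB₁) (hs hB₂ hA₂) h1
  rw [h2, eq_comm, smul_eq_zero, or_iff_right Complex.I_ne_zero] at h1
  exact ⟨sub_eq_zero.1 h2, (sub_eq_zero.1 h1).symm⟩

/-- `components` is made by choice; uniqueness of the decomposition identifies the chosen pair. -/
theorem components_add_smul_I {K : Subgroup (GLin V)} (hK : IsCompact (K : Set (GLin V)))
    {A₁ A₂ : V →L[ℂ] V} (hA₁ : A₁ ∈ realLieAlgebra K) (hA₂ : A₂ ∈ realLieAlgebra K) :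
    components (realLieAlgebra K) (A₁ + Complex.I • A₂) = (A₁, A₂) := by
  have h : ∃ p : (V →L[ℂ] V) × (V →L[ℂ] V), p.1 ∈ realLieAlgebra K ∧ p.2 ∈ realLieAlgebra K ∧
      A₁ + Complex.I • A₂ = p.1 + Complex.I • p.2 := ⟨(A₁, A₂), hA₁, hA₂, rfl⟩
  rw [components, dif_pos h]
  obtain ⟨h1, h2, h3⟩ := h.choose_spec
  obtain ⟨h4, h5⟩ := add_smul_I_injective hK hA₁ hA₂ h1 h2 h3
  exact Prod.ext h4.symm h5.symm

/-- Both sides are sesquilinear over `Lie(K) ⊕ √-1 Lie(K) = End V` and agree on `Lie(K)`. -/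
theorem innerEnd_eq_traceInner {K : Subgroup (GLin V)} (hK : IsMaximalCompact K ⊤) {n : ℕ}
    {e : V ≃L[ℂ] EuclideanSpace ℂ (Fin n)}
    (he : ∀ k ∈ K, e.conjContinuousAlgEquiv (k : V →L[ℂ] V) ∈
        unitary (EuclideanSpace ℂ (Fin n) →L[ℂ] EuclideanSpace ℂ (Fin n))) :
    innerEnd K = traceInner e := by
  have hdec : ∀ A : V →L[ℂ] V, ∃ A₁ ∈ realLieAlgebra K, ∃ A₂ ∈ realLieAlgebra K,
      A = A₁ + Complex.I • A₂ := by
    intro A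
    set B := e.conjContinuousAlgEquiv A with hB
    have hsub : star (B - star B) = star B - B := (map_sub ContinuousLinearMap.adjoint _ _).trans
      (congrArg _ (star_star B))
    have hadd : star (B + star B) = star B + B := (map_add ContinuousLinearMap.adjoint _ _).trans
      (congrArg _ (star_star B))
    -- The skew-Hermitian part of `B`, and its Hermitian part divided by `√-1`.
    refine ⟨e.conjContinuousAlgEquiv.symm ((1 / 2 : ℂ) • (B - star B)), ?_,
      e.conjContinuousAlgEquiv.symm (-(Complex.I / 2) • (B + star B)), ?_, ?_⟩
    · rw [mem_realLieAlgebra_iff_of_isMaximalCompact hK he,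
        ContinuousAlgEquiv.apply_symm_apply, star_smul, hsub, ← smul_neg, neg_sub]
      simp
    · rw [mem_realLieAlgebra_iff_of_isMaximalCompact hK he,
        ContinuousAlgEquiv.apply_symm_apply, star_smul, hadd, add_comm, ← neg_smul]
      congr 1
      simp [neg_div]
    · refine e.conjContinuousAlgEquiv.injective ?_
      change B = e.conjContinuousAlgEquiv _
      simp only [map_add, map_smul, ContinuousAlgEquiv.apply_symm_apply, smul_smul]
      have : Complex.I * -(Complex.I / 2) = 1 / 2 := by
        rw [mul_neg, ← mul_div_assoc, Complex.I_mul_I]; norm_num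
      rw [this, ← smul_add, sub_add_add_cancel, ← two_smul ℂ, smul_smul]
      norm_num
  have hT := isHermitianInner_traceInner e
  funext A B
  obtain ⟨A₁, hA₁, A₂, hA₂, rfl⟩ := hdec A
  obtain ⟨B₁, hB₁, B₂, hB₂, rfl⟩ := hdec B
  have h1 := conj_realLieAlgebra_mem_skewAdjoint he hB₁
  have h2 := conj_realLieAlgebra_mem_skewAdjoint he hB₂
  simp only [innerEnd, hermitianExtension, components_add_smul_I hK.compact hA₁ hA₂,
    components_add_smul_I hK.compact hB₁ hB₂, negTrace_eq_traceInner h1,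
    negTrace_eq_traceInner h2, hT.add_left, hT.smul_left, hT.add_right, hT.smul_right,
    Complex.conj_I]
  linear_combination traceInner e A₂ B₂ * Complex.I_sq

theorem isHermitianInner_innerEnd {K : Subgroup (GLin V)} (hK : IsMaximalCompact K ⊤) :
    IsHermitianInner (innerEnd K) := by
  obtain ⟨n, e, he⟩ := exists_unitary_coordinates hK.compact
  rw [innerEnd_eq_traceInner hK he]
  exact isHermitianInner_traceInner e

theorem innerEnd_conj {K : Subgroup (GLin V)} (hK : IsMaximalCompact K ⊤) {k : GLin V}
    (hk : k ∈ K) (A B : V →L[ℂ] V) :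
    innerEnd K ((k : V →L[ℂ] V) * A * ((k⁻¹ : GLin V) : V →L[ℂ] V))
      ((k : V →L[ℂ] V) * B * ((k⁻¹ : GLin V) : V →L[ℂ] V)) = innerEnd K A B := by
  obtain ⟨n, e, he⟩ := exists_unitary_coordinates hK.compact
  rw [innerEnd_eq_traceInner hK he]
  exact traceInner_conj (he k hk) A B

end HermitianForms

/-! ### The differential of a representation -/

section Representations

variable {U : Type*} [NormedAddCommGroup U] [NormedSpace ℂ U] [FiniteDimensional ℂ U]
variable {V : Type*} [NormedAddCommGroup V] [NormedSpace ℂ V] [FiniteDimensional ℂ V]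
variable {G K : Subgroup (GLin U)}

/-- A representation maps the one-parameter group of `A` to that of its differential at `A`. -/
theorem RationalRep.ext_exp (ρ : RationalRep G V) (hKG : K ≤ G) {A : U →L[ℂ] U}
    (hA : A ∈ realLieAlgebra K) (t : ℝ) :
    ρ.ext (NormedSpace.exp (t • A)) = NormedSpace.exp (t • ρ.differential A) := by
  have : CompleteSpace U := FiniteDimensional.complete ℂ U
  have : CompleteSpace V := FiniteDimensional.complete ℂ V
  let _ : NormedAlgebra ℚ (U →L[ℂ] U) := .restrictScalars ℚ ℂ _
  let _ : NormedAlgebra ℚ (V →L[ℂ] V) := .restrictScalars ℚ ℂ _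
  set B := ρ.differential A with hB
  let F : ℝ → (V →L[ℂ] V) := fun t => ρ.ext (NormedSpace.exp (t • A))
  -- The exponentials lie in `K ⊆ G`, where the extension `ρ.ext` is multiplicative.
  have hadd : ∀ s t, F (s + t) = F s * F t := by
    intro s t
    obtain ⟨k, hk, hks⟩ := hA s
    obtain ⟨l, hl, hlt⟩ := hA t
    have h1 : NormedSpace.exp ((s + t) • A) = ((k * l : GLin U) : U →L[ℂ] U) := by
      rw [add_smul, NormedSpace.exp_add_of_commute
        (((Commute.refl A).smul_left s).smul_right t), Units.val_mul, hks, hlt]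
    simp only [F]
    rw [h1, ← hks, ← hlt, ρ.ext_apply ⟨k * l, hKG (K.mul_mem hk hl)⟩, ρ.ext_apply ⟨k, hKG hk⟩,
      ρ.ext_apply ⟨l, hKG hl⟩, ← Units.val_mul, ← map_mul]
    rfl
  have hF0 : F 0 = 1 := by
    have := ρ.ext_apply 1
    simpa [F] using this
  have hd0 : HasDerivAt F B 0 := by
    have h1 : HasFDerivAt ρ.ext (ρ.differential.restrictScalars ℝ)
        (NormedSpace.exp ((0 : ℝ) • A)) := by
      rw [zero_smul, NormedSpace.exp_zero]
      exact ((ρ.ext_regular.contDiffAt 1).differentiableAt (by simp)).hasFDerivAt.restrictScalars ℝ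
    have h2 : HasDerivAt F _ 0 := h1.comp_hasDerivAt (0 : ℝ) (hasDerivAt_exp_smul_const (𝕂 := ℝ) A (0 : ℝ))
    simpa [B] using h2
  have hd : ∀ t, HasDerivAt F (F t * B) t := by
    intro t
    have h1 : HasDerivAt (fun s => F t * F (s - t)) (F t * B) t := by
      refine HasDerivAt.const_mul (F t) ?_
      have h2 : HasDerivAt F B (t - t) := by rwa [sub_self]
      exact h2.comp_sub_const t t
    refine h1.congr_of_eventuallyEq (Filter.Eventually.of_forall fun s => ?_)
    simp only [← hadd, add_sub_cancel]
  -- Uniqueness for `F' = F B`, `F 0 = 1`: this product has zero derivative.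
  have hc : ∀ t, F t * NormedSpace.exp (t • -B) = 1 := by
    intro t
    have h1 : ∀ s, HasDerivAt (fun s : ℝ => F s * NormedSpace.exp (s • -B)) 0 s := by
      intro s
      have := (hd s).mul (hasDerivAt_exp_smul_const' (𝕂 := ℝ) (-B) s)
      rwa [neg_mul, mul_neg, mul_assoc, add_neg_cancel] at this
    have h2 := is_const_of_deriv_eq_zero (fun s => (h1 s).differentiableAt)
      (fun s => (h1 s).deriv) t 0
    simpa [hF0] using h2
  have h3 : NormedSpace.exp (t • -B) * NormedSpace.exp (t • B) = 1 := by
    rw [← NormedSpace.exp_add_of_commute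
      (((Commute.refl B).neg_left.smul_left t).smul_right t), smul_neg, neg_add_cancel,
      NormedSpace.exp_zero]
  calc F t = F t * (NormedSpace.exp (t • -B) * NormedSpace.exp (t • B)) := by rw [h3, mul_one]
    _ = _ := by rw [← mul_assoc, hc, one_mul]

variable {K' : Subgroup (GLin V)} {ρ : RationalRep G V}

theorem RationalRep.differential_mem_realLieAlgebra (hKG : K ≤ G)
    (hKK' : ∀ g : G, (g : GLin U) ∈ K → ρ.toHom g ∈ K') {A : U →L[ℂ] U}
    (hA : A ∈ realLieAlgebra K) : ρ.differential A ∈ realLieAlgebra K' := by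
  intro t
  obtain ⟨k, hk, hkt⟩ := hA t
  refine ⟨_, hKK' ⟨k, hKG hk⟩ hk, ?_⟩
  rw [← ρ.ext_exp hKG hA t, ← hkt]
  exact (ρ.ext_apply ⟨k, hKG hk⟩).symm

/-- A faithful representation is injective on the Lie algebra of `K`. -/
theorem RationalRep.eq_zero_of_differential_eq_zero (hKG : K ≤ G)
    (hρ : Function.Injective ρ.toHom) {A : U →L[ℂ] U} (hA : A ∈ realLieAlgebra K)
    (h : ρ.differential A = 0) : A = 0 := by
  have : CompleteSpace U := FiniteDimensional.complete ℂ U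
  -- `ρ` sends `exp(tA)` to `exp(0) = 1`, so faithfulness applies; differentiating at `0` then gives
  -- `A = 0`.
  have h1 : ∀ t : ℝ, NormedSpace.exp (t • A) = 1 := by
    intro t
    obtain ⟨k, hk, hkt⟩ := hA t
    have h2 := ρ.ext_exp hKG hA t
    rw [h, smul_zero, NormedSpace.exp_zero, ← hkt] at h2
    have h3 : ρ.toHom ⟨k, hKG hk⟩ = 1 := Units.ext ((ρ.ext_apply ⟨k, hKG hk⟩).symm.trans h2)
    have h4 : k = 1 := congrArg Subtype.val (hρ (h3.trans (map_one _).symm))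
    rw [← hkt, h4, Units.val_one]
  have h2 := (hasDerivAt_exp_smul_const (𝕂 := ℝ) A (0 : ℝ)).unique
    ((hasDerivAt_const (0 : ℝ) (1 : U →L[ℂ] U)).congr_of_eventuallyEq
      (Filter.Eventually.of_forall h1))
  simpa using h2

/-- `dρ` maps the `𝔨`-components of an element of `𝔤` to the `Lie(K')`-components of its image, so
both sides evaluate the same trace form on the same vectors. -/
theorem RationalRep.innerEnd_differential (hG : IsConnectedReductive G) (hK : IsMaximalCompact K G)
    (hK' : IsMaximalCompact K' ⊤) (hKK' : ∀ g : G, (g : GLin U) ∈ K → ρ.toHom g ∈ K')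
    {A B : U →L[ℂ] U} (hA : A ∈ lieAlgebra G) (hB : B ∈ lieAlgebra G) :
    innerEnd K' (ρ.differential A) (ρ.differential B) = innerLie K ρ A B := by
  obtain ⟨A₁, hA₁, A₂, hA₂, rfl⟩ := (hG.span K hK A).1 hA
  obtain ⟨B₁, hB₁, B₂, hB₂, rfl⟩ := (hG.span K hK B).1 hB
  have h := fun {C : U →L[ℂ] U} (hC : C ∈ realLieAlgebra K) =>
    RationalRep.differential_mem_realLieAlgebra (ρ := ρ) hK.le hKK' hC
  simp only [innerEnd, innerLie, hermitianExtension, map_add, map_smul,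
    components_add_smul_I hK'.compact (h hA₁) (h hA₂),
    components_add_smul_I hK'.compact (h hB₁) (h hB₂),
    components_add_smul_I hK.compact hA₁ hA₂, components_add_smul_I hK.compact hB₁ hB₂]

/-- If `dρ(A₁ + √-1 A₂) = 0`, uniqueness of the decomposition in `End V` kills both `dρ(Aⱼ)`, and
faithfulness kills both `Aⱼ`. -/
theorem RationalRep.differential_injOn (hG : IsConnectedReductive G) (hK : IsMaximalCompact K G)
    (hρ : Function.Injective ρ.toHom) (hK' : IsMaximalCompact K' ⊤)
    (hKK' : ∀ g : G, (g : GLin U) ∈ K → ρ.toHom g ∈ K') :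
    Set.InjOn ρ.differential (lieAlgebra G) := by
  intro A hA B hB hAB
  obtain ⟨A₁, hA₁, A₂, hA₂, h⟩ := (hG.span K hK (A - B)).1 ((lieAlgebra G).sub_mem hA hB)
  have h0 : (0 : U →L[ℂ] U) ∈ realLieAlgebra K := fun t => ⟨1, K.one_mem, by simp⟩
  have hm := fun {C : U →L[ℂ] U} (hC : C ∈ realLieAlgebra K) =>
    RationalRep.differential_mem_realLieAlgebra (ρ := ρ) hK.le hKK' hC
  have h1 : ρ.differential A₁ + Complex.I • ρ.differential A₂ =
      ρ.differential 0 + Complex.I • ρ.differential 0 := by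
    rw [← map_smul, ← map_add, ← h, map_sub, hAB, sub_self, map_zero, smul_zero, add_zero]
  obtain ⟨h2, h3⟩ := add_smul_I_injective hK'.compact (hm hA₁) (hm hA₂) (hm h0) (hm h0) h1
  rw [map_zero] at h2 h3
  rw [RationalRep.eq_zero_of_differential_eq_zero hK.le hρ hA₁ h2,
    RationalRep.eq_zero_of_differential_eq_zero hK.le hρ hA₂ h3, smul_zero, add_zero] at h
  exact sub_eq_zero.1 h

end Representations

/-! ### Definiteness of the `L²` metric -/

section Definiteness

open MeasureTheory

variable {V : Type*} [NormedAddCommGroup V] [NormedSpace ℂ V]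
variable {X : Type*} [TopologicalSpace X] [ChartedSpace ℂ X] {ι : Type*}
variable {c : Cocycle ι X V} {𝔤 : Submodule ℂ (V →L[ℂ] V)} {σ : ℂ →+* ℂ}
variable {h : (V →L[ℂ] V) → (V →L[ℂ] V) → ℂ}

theorem coordVec_smul (e : OpenPartialHomeomorph X ℂ) (z w : ℂ) :
    coordVec e z w = w • coordVec e z 1 := by
  have := (mfderiv 𝓘(ℂ, ℂ) 𝓘(ℂ, ℂ) e.symm z).map_smul w (1 : ℂ)
  have h1 : w = w • (1 : ℂ) := (mul_one w).symm
  exact (congrArg (mfderiv 𝓘(ℂ, ℂ) 𝓘(ℂ, ℂ) e.symm z) h1).trans this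

theorem exists_eq_smul_coordVec [IsManifold 𝓘(ℂ, ℂ) ω X] {e : OpenPartialHomeomorph X ℂ}
    (he : e ∈ atlas ℂ X) {z : ℂ} (hz : z ∈ e.target) (v : TangentSpace 𝓘(ℂ, ℂ) (e.symm z)) :
    ∃ w : ℂ, v = w • coordVec e z 1 := by
  have : IsManifold 𝓘(ℂ, ℂ) 1 X := IsManifold.of_le (n := ω) le_top
  obtain ⟨w, hw⟩ :=
    (mdifferentiable_of_mem_atlas (I := 𝓘(ℂ, ℂ)) he).symm.mfderiv_surjective hz v
  exact ⟨w, hw.symm.trans (coordVec_smul e z w)⟩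

/-- A form vanishes when its coefficients do, in some chart around each point. -/
theorem AdForm.eq_zero_of_coeff [IsManifold 𝓘(ℂ, ℂ) ω X] {a : AdForm σ c 𝔤}
    (ha : ∀ x, ∃ e ∈ atlas ℂ X, x ∈ e.source ∧ ∀ i, x ∈ c.base i → a.coeff i e (e x) = 0) :
    a = 0 := by
  refine AdForm.ext (funext fun i => funext fun x => ?_)
  by_cases hx : x ∈ c.base i
  · obtain ⟨e, he, hxe, hae⟩ := ha x
    -- `coordVec` lives in the tangent space at `e.symm (e x)`; the passage to `x` comes afterwards.
    have key : a.val i (e.symm (e x)) = 0 := by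
      ext1 v
      obtain ⟨w, rfl⟩ := exists_eq_smul_coordVec he (e.map_source hxe) v
      rw [map_smulₛₗ]
      have h1 : a.val i (e.symm (e x)) (coordVec e (e x) 1) = 0 := hae i hx
      rw [h1, smul_zero]
      rfl
    rw [e.left_inv hxe] at key
    exact key
  · exact a.off i x hx

/-- `σ(√-1)` is a square root of `-1`, hence `±√-1`. This treats both types of forms at once. -/
theorem conj_map_I (σ : ℂ →+* ℂ) : starRingEnd ℂ (σ Complex.I) = -σ Complex.I := by
  have h1 : σ Complex.I * σ Complex.I = -1 := by
    rw [← map_mul, Complex.I_mul_I, map_neg, map_one]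
  have h2 : (σ Complex.I - Complex.I) * (σ Complex.I + Complex.I) = 0 := by
    linear_combination h1 - Complex.I_mul_I
  rcases mul_eq_zero.1 h2 with h3 | h3
  · rw [sub_eq_zero.1 h3, Complex.conj_I]
  · rw [eq_neg_of_add_eq_zero_left h3, map_neg, Complex.conj_I]

/-- The squared length of the coefficient of a form in the chart `e`. -/
def AdForm.density (h : (V →L[ℂ] V) → (V →L[ℂ] V) → ℂ) (a : AdForm σ c 𝔤)
    (e : OpenPartialHomeomorph X ℂ) (z : ℂ) : ℝ :=
  (h (a.coeff (c.cover (e.symm z)).choose e z) (a.coeff (c.cover (e.symm z)).choose e z)).re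

/-- Since `∂/∂y = √-1 ∂/∂x`, the value is `(conj(σ(√-1)) - σ(√-1))` times the density. -/
theorem wedgeConj_self (hh : IsHermitianInner h) (a : AdForm σ c 𝔤)
    (e : OpenPartialHomeomorph X ℂ) (z : ℂ) :
    wedgeConj h a a (e.symm z) (coordVec e z 1) (coordVec e z Complex.I) =
      -2 * σ Complex.I * (a.density h e z : ℂ) := by
  rw [coordVec_smul e z Complex.I]
  simp only [wedgeConj, AdForm.density, AdForm.coeff, map_smulₛₗ, hh.ofReal_re, hh.smul_left,
    hh.smul_right, conj_map_I]
  ring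

/-- The inner product `h` is invariant under the transition functions. -/
def IsInvariantInner (c : Cocycle ι X V) (h : (V →L[ℂ] V) → (V →L[ℂ] V) → ℂ) : Prop :=
  ∀ i j, ∀ x ∈ c.base i ∩ c.base j, ∀ A B,
    h ((c.g i j x : V →L[ℂ] V) * A * ((c.g i j x)⁻¹ : GLin V))
      ((c.g i j x : V →L[ℂ] V) * B * ((c.g i j x)⁻¹ : GLin V)) = h A B

/-- The density uses a frame chosen arbitrarily at each point; invariance of `h` allows one fixed
frame near a point, which is what continuity requires. -/
theorem AdForm.density_eq (hc : IsInvariantInner c h) (a : AdForm σ c 𝔤)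
    (e : OpenPartialHomeomorph X ℂ) {z : ℂ} {i : ι} (hi : e.symm z ∈ c.base i) :
    a.density h e z = (h (a.coeff i e z) (a.coeff i e z)).re := by
  have hx : e.symm z ∈ c.base (c.cover (e.symm z)).choose ∩ c.base i :=
    ⟨(c.cover (e.symm z)).choose_spec, hi⟩
  rw [AdForm.density, AdForm.coeff, a.equivariant _ i _ hx, hc _ _ _ hx]
  rfl

theorem AdForm.continuousOn_density (hh : IsHermitianInner h) (hc : IsInvariantInner c h)
    (a : AdForm σ c 𝔤) {e : OpenPartialHomeomorph X ℂ} (he : e ∈ atlas ℂ X) :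
    ContinuousOn (a.density h e) e.target := by
  intro z hz
  obtain ⟨i, hi⟩ := c.cover (e.symm z)
  have hn : e.target ∩ e.symm ⁻¹' c.base i ∈ 𝓝 z := (isOpen_dom c i e).mem_nhds ⟨hz, hi⟩
  have h1 : ContinuousAt (a.coeff i e) z := (a.contDiffOn_coeff i e he).continuousOn.continuousAt hn
  refine ContinuousAt.continuousWithinAt ((hh.continuous.continuousAt.comp h1).congr ?_)
  filter_upwards [hn] with w hw
  exact (a.density_eq hc e hw.2).symm

theorem AdForm.density_nonneg (hh : IsHermitianInner h) (a : AdForm σ c 𝔤)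
    (e : OpenPartialHomeomorph X ℂ) (z : ℂ) : 0 ≤ a.density h e z := hh.nonneg _

variable [T2Space X] [CompactSpace X]

/-- The partition of unity that is used for integration. -/
def chartPartition (X : Type*) [TopologicalSpace X] [ChartedSpace ℂ X] [T2Space X]
    [CompactSpace X] : PartitionOfUnity X X Set.univ :=
  (exists_chart_partition (X := X)).choose

theorem tsupport_chartPartition (x₀ : X) :
    tsupport (chartPartition X x₀) ⊆ (chartAt ℂ x₀).source :=
  (exists_chart_partition (X := X)).choose_spec x₀

/-- The part of the squared norm of a form that belongs to the chart at `x₀`. -/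
def AdForm.localEnergy (h : (V →L[ℂ] V) → (V →L[ℂ] V) → ℂ) (a : AdForm σ c 𝔤) (x₀ : X) : ℝ :=
  ∫ z in (chartAt ℂ x₀).target,
    chartPartition X x₀ ((chartAt ℂ x₀).symm z) * a.density h (chartAt ℂ x₀) z

theorem integral2_wedgeConj_self (hh : IsHermitianInner h) (a : AdForm σ c 𝔤) :
    integral2 (wedgeConj h a a) =
      -2 * σ Complex.I * ((∑ᶠ x₀, a.localEnergy h x₀ : ℝ) : ℂ) := by
  have hne : -2 * σ Complex.I ≠ 0 :=
    mul_ne_zero (by norm_num) ((map_ne_zero σ).2 Complex.I_ne_zero)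
  let L : ℝ →+ ℂ := (AddMonoidHom.mulLeft (-2 * σ Complex.I)).comp
    (Complex.ofRealHom : ℝ →+* ℂ).toAddMonoidHom
  -- An injective homomorphism commutes with `finsum` with no finiteness condition.
  have hL : Function.Injective L := fun r s hrs => Complex.ofReal_injective (mul_left_cancel₀ hne hrs)
  refine Eq.trans ?_ (L.map_finsum_of_injective hL _).symm
  refine finsum_congr fun x₀ => ?_
  change _ = -2 * σ Complex.I * ((a.localEnergy h x₀ : ℝ) : ℂ)
  rw [AdForm.localEnergy, ← integral_complex_ofReal, ← integral_const_mul]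
  refine integral_congr_ae (Filter.Eventually.of_forall fun z => ?_)
  simp only [wedgeConj_self hh]
  rw [Complex.ofReal_mul, chartPartition]
  ring

theorem AdForm.localEnergy_nonneg (hh : IsHermitianInner h) (a : AdForm σ c 𝔤) (x₀ : X) :
    0 ≤ a.localEnergy h x₀ :=
  integral_nonneg fun z => mul_nonneg ((chartPartition X).nonneg x₀ _) (a.density_nonneg hh _ z)

/-- A locally finite family on a compact space has finitely many nonzero members. Without this the
`finsum` could be the default `0` and would not bound its terms. -/
theorem AdForm.finite_support_localEnergy (a : AdForm σ c 𝔤) :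
    (Function.support fun x₀ => a.localEnergy h x₀).Finite := by
  refine ((chartPartition X).locallyFinite.finite_nonempty_of_compact).subset fun x₀ hx₀ => ?_
  by_contra hne
  rw [Set.mem_ofPred_eq, Set.not_nonempty_iff_eq_empty, Function.support_eq_empty_iff] at hne
  refine hx₀ ?_
  simp only [AdForm.localEnergy, hne, Pi.zero_apply, zero_mul, integral_zero]

/-- A continuous nonnegative function with zero integral over an open set vanishes there. -/
theorem AdForm.density_eq_zero (hh : IsHermitianInner h) (hc : IsInvariantInner c h)
    {a : AdForm σ c 𝔤} {x₀ : X} (ha : a.localEnergy h x₀ = 0) {z : ℂ}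
    (hz : z ∈ (chartAt ℂ x₀).target) :
    chartPartition X x₀ ((chartAt ℂ x₀).symm z) * a.density h (chartAt ℂ x₀) z = 0 := by
  set e := chartAt ℂ x₀ with he
  set φ : ℂ → ℝ := fun z => chartPartition X x₀ (e.symm z) * a.density h e z with hφ
  have hcont : ContinuousOn φ e.target :=
    ((chartPartition X x₀).continuous.comp_continuousOn e.continuousOn_symm).mul
      (a.continuousOn_density hh hc (chart_mem_atlas ℂ x₀))
  have hK : IsCompact (e '' tsupport (chartPartition X x₀)) :=
    (isClosed_tsupport _).isCompact.image_of_continuousOn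
      (e.continuousOn.mono (tsupport_chartPartition x₀))
  have hKt : e '' tsupport (chartPartition X x₀) ⊆ e.target := by
    rintro _ ⟨x, hx, rfl⟩
    exact e.map_source (tsupport_chartPartition x₀ hx)
  -- The integrand vanishes off the compact image of the support of the partition function. Without
  -- integrability the integral would be `0` by default and carry no information.
  have hint : IntegrableOn φ e.target := by
    refine ((hcont.mono hKt).integrableOn_compact hK).of_forall_sdiff_eq_zero
      e.open_target.measurableSet fun w hw => ?_
    have : e.symm w ∉ tsupport (chartPartition X x₀) := fun hw' =>
      hw.2 ⟨_, hw', e.right_inv hw.1⟩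
    simp only [hφ, image_eq_zero_of_notMem_tsupport this, zero_mul]
  have hnn : 0 ≤ᵐ[volume.restrict e.target] φ := Filter.Eventually.of_forall fun w =>
    mul_nonneg ((chartPartition X).nonneg x₀ _) (a.density_nonneg hh _ w)
  have h0 := (setIntegral_eq_zero_iff_of_nonneg_ae hnn hint).1 ha
  exact Measure.eqOn_open_of_ae_eq h0 e.open_target hcont continuousOn_const hz

/-- The `L²` norm of forms is definite. -/
theorem AdForm.eq_zero_of_finsum_localEnergy [IsManifold 𝓘(ℂ, ℂ) ω X] (hh : IsHermitianInner h)
    (hc : IsInvariantInner c h) {a : AdForm σ c 𝔤} (ha : ∑ᶠ x₀, a.localEnergy h x₀ = 0) :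
    a = 0 := by
  refine AdForm.eq_zero_of_coeff fun x => ?_
  obtain ⟨x₀, hx₀⟩ := (chartPartition X).exists_pos (Set.mem_univ x)
  have hxs : x ∈ (chartAt ℂ x₀).source :=
    tsupport_chartPartition x₀ (subset_tsupport _ hx₀.ne')
  refine ⟨chartAt ℂ x₀, chart_mem_atlas ℂ x₀, hxs, fun i hi => ?_⟩
  have h1 : a.localEnergy h x₀ = 0 := le_antisymm
    (ha ▸ single_le_finsum x₀ a.finite_support_localEnergy (a.localEnergy_nonneg hh))
    (a.localEnergy_nonneg hh x₀)
  have h2 := AdForm.density_eq_zero hh hc h1 ((chartAt ℂ x₀).map_source hxs)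
  have h3 : (chartAt ℂ x₀).symm (chartAt ℂ x₀ x) = x := (chartAt ℂ x₀).left_inv hxs
  rw [a.density_eq hc (i := i) _ (h3.symm ▸ hi), h3] at h2
  exact hh.definite _ ((mul_eq_zero.1 h2).resolve_left hx₀.ne')

theorem integral2_conj (η : (x : X) → TangentSpace 𝓘(ℂ, ℂ) x → TangentSpace 𝓘(ℂ, ℂ) x → ℂ) :
    integral2 (fun x v w => starRingEnd ℂ (η x v w)) = starRingEnd ℂ (integral2 η) := by
  refine Eq.trans ?_ ((starRingEnd ℂ).toAddMonoidHom.map_finsum_of_injective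
    (starRingEnd ℂ).injective _).symm
  refine finsum_congr fun x₀ => ?_
  refine Eq.trans ?_ integral_conj
  refine integral_congr_ae (Filter.Eventually.of_forall fun z => ?_)
  simp

theorem integral2_neg (η : (x : X) → TangentSpace 𝓘(ℂ, ℂ) x → TangentSpace 𝓘(ℂ, ℂ) x → ℂ) :
    integral2 (fun x v w => -(η x v w)) = -integral2 η := by
  simp only [integral2, mul_neg, integral_neg, finsum_neg_distrib]

/-- Conjugation exchanges the two terms of the wedge product. Multiplication by `√-1` makes this
skew-Hermitian pairing Hermitian, so the metric is symmetric. -/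
theorem integral2_wedgeConj_symm (hh : IsHermitianInner h) (a b : AdForm σ c 𝔤) :
    integral2 (wedgeConj h b a) = -starRingEnd ℂ (integral2 (wedgeConj h a b)) := by
  rw [← integral2_conj, ← integral2_neg]
  congr 1
  funext x v w
  simp only [wedgeConj, map_sub, hh.conj_symm]
  ring

theorem riemannianMetric_symm (hh : IsHermitianInner h) (p : HiggsSpace c 𝔤)
    (u v : HiggsTangent c 𝔤) : riemannianMetric h p u v = riemannianMetric h p v u := by
  simp only [riemannianMetric, hermitianProduct, integral2_wedgeConj_symm hh u.1 v.1,
    integral2_wedgeConj_symm hh u.2 v.2]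
  simp

theorem riemannianMetric_zero_left (hh : IsHermitianInner h) (p : HiggsSpace c 𝔤)
    (u : HiggsTangent c 𝔤) : riemannianMetric h p 0 u = 0 := by
  have h1 : ∀ {σ : ℂ →+* ℂ} (a : AdForm σ c 𝔤), integral2 (wedgeConj h 0 a) = 0 := by
    intro σ a
    have : wedgeConj h (0 : AdForm σ c 𝔤) a = fun _ _ _ => 0 := by
      funext x v w
      have h2 : ∀ v, (0 : AdForm σ c 𝔤).val (c.cover x).choose x v = 0 := fun _ => rfl
      simp only [wedgeConj, h2, hh.zero_left, sub_zero]
    simp [this, integral2]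
  simp [riemannianMetric, hermitianProduct, h1]

/-- The metric on the space of pairs is definite. -/
theorem eq_zero_of_riemannianMetric_self [IsManifold 𝓘(ℂ, ℂ) ω X] (hh : IsHermitianInner h)
    (hc : IsInvariantInner c h) (p : HiggsSpace c 𝔤) {u : HiggsTangent c 𝔤}
    (hu : riemannianMetric h p u u = 0) : u = 0 := by
  have h1 := finsum_nonneg (u.1.localEnergy_nonneg hh)
  have h2 := finsum_nonneg (u.2.localEnergy_nonneg hh)
  -- The factor `-2 σ(√-1)` is `-2√-1` on `(1,0)`-forms and `2√-1` on `(0,1)`-forms, so the opposite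
  -- signs in `hermitianProduct` give twice the energy in both cases.
  simp only [riemannianMetric, hermitianProduct, integral2_wedgeConj_self hh] at hu
  simp at hu
  exact Prod.ext (AdForm.eq_zero_of_finsum_localEnergy hh hc (by linarith))
    (AdForm.eq_zero_of_finsum_localEnergy hh hc (by linarith))

end Definiteness

/-! ### The `C^∞` topology and velocities -/

section SmoothTopology

open Filter

variable {V : Type*} [NormedAddCommGroup V] [NormedSpace ℂ V]
variable {X : Type*} [TopologicalSpace X] [ChartedSpace ℂ X] {ι : Type*}
variable {c : Cocycle ι X V} {𝔤 : Submodule ℂ (V →L[ℂ] V)} {σ : ℂ →+* ℂ}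

theorem AdForm.tendsto_nhds_iff {α : Type*} {f : α → AdForm σ c 𝔤} {l : Filter α}
    {a : AdForm σ c 𝔤} :
    Tendsto f l (𝓝 a) ↔
      ∀ s : AdForm.SeminormIndex c, Tendsto (fun t => AdForm.supSeminorm s (f t - a)) l (𝓝 0) := by
  rw [nhds_iInf, tendsto_iInf]
  refine forall_congr' fun s => ?_
  let _ := (AdForm.supSeminorm (σ := σ) (𝔤 := 𝔤) s).toSeminormedAddCommGroup
  exact tendsto_iff_norm_sub_tendsto_zero

/-- The `C^∞` topology separates forms. -/
theorem AdForm.eq_zero_of_tendsto_zero [IsManifold 𝓘(ℂ, ℂ) ω X] {α : Type*} {l : Filter α}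
    [l.NeBot] {a : AdForm σ c 𝔤} (h : Tendsto (fun _ : α => (0 : AdForm σ c 𝔤)) l (𝓝 a)) :
    a = 0 := by
  refine AdForm.eq_zero_of_coeff fun x => ⟨chartAt ℂ x, chart_mem_atlas ℂ x,
    mem_chart_source ℂ x, fun i hi => ?_⟩
  have hx : (chartAt ℂ x).symm (chartAt ℂ x x) = x :=
    (chartAt ℂ x).left_inv (mem_chart_source ℂ x)
  -- The order zero seminorm on a single point is the norm of the coefficient there.
  let s : AdForm.SeminormIndex c :=
    { i := i, e := chartAt ℂ x, he := chart_mem_atlas ℂ x, k := 0, C := {chartAt ℂ x x}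
      compact := isCompact_singleton
      subset := Set.singleton_subset_iff.2
        ⟨mem_chart_target ℂ x, by rw [Set.mem_preimage, hx]; exact hi⟩ }
  have h1 : AdForm.supSeminorm s (0 - a) = 0 :=
    tendsto_nhds_unique tendsto_const_nhds (AdForm.tendsto_nhds_iff.1 h s)
  rw [zero_sub, map_neg_eq_map] at h1
  have h2 := (le_ciSup (a.bddAbove_coeff s) ⟨chartAt ℂ x x, rfl⟩).trans_eq h1
  rw [norm_iteratedFDeriv_zero] at h2
  exact norm_le_zero_iff.1 h2

theorem hasVelocity_line (u : HiggsTangent c 𝔤) (p : HiggsSpace c 𝔤) :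
    HasVelocity (fun t : ℝ => t • u +ᵥ p) u 0 := by
  refine tendsto_const_nhds.congr' ?_
  filter_upwards [self_mem_nhdsWithin] with s hs
  rw [zero_add, zero_smul, zero_vadd, HiggsSpace.vadd_vsub_cancel, inv_smul_smul₀ hs]

theorem hasVelocity_const {F : Type*} [AddCommGroup F] [Module ℝ F] [TopologicalSpace F] (v : F)
    (t : ℝ) : HasVelocity (fun _ : ℝ => v) (0 : F) t := by
  refine tendsto_const_nhds.congr fun s => ?_
  rw [vsub_self, smul_zero]

/-- `HasVelocity` only asserts a limit; separation of the topology makes it unique here, which pins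
down the derivative of `dφ(v)`. -/
theorem eq_zero_of_hasVelocity_const [IsManifold 𝓘(ℂ, ℂ) ω X]
    {v D : HiggsTangent c 𝔤} {t : ℝ}
    (h : HasVelocity (fun _ : ℝ => v) D t) : D = 0 := by
  have h1 : Tendsto (fun _ : ℝ => (0 : HiggsTangent c 𝔤)) (𝓝[≠] 0) (𝓝 D) :=
    h.congr fun s => by rw [vsub_self, smul_zero]
  rw [nhds_prod_eq, tendsto_prod_iff'] at h1
  exact Prod.ext (AdForm.eq_zero_of_tendsto_zero h1.1) (AdForm.eq_zero_of_tendsto_zero h1.2)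

end SmoothTopology

/-! ### The affine map `φ` and its linear part -/

section Pushforward

open Filter

variable {U : Type*} [NormedAddCommGroup U] [NormedSpace ℂ U] [FiniteDimensional ℂ U]
variable {V : Type*} [NormedAddCommGroup V] [NormedSpace ℂ V] [FiniteDimensional ℂ V]
variable {G K : Subgroup (GLin U)} {X : Type*} [TopologicalSpace X] [ChartedSpace ℂ X] {ι : Type*}
variable {σ : ℂ →+* ℂ} {E : PrincipalBundle ι X K} {hKG : K ≤ G} {ρ : RationalRep G V}

theorem AdForm.push_sub (a b : AdForm σ E.toCocycle (lieAlgebra G)) :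
    (a - b).push E hKG ρ = a.push E hKG ρ - b.push E hKG ρ := by
  refine AdForm.ext (funext fun i => funext fun x => ?_)
  ext1 v
  exact map_sub ρ.differential _ _

theorem AdForm.push_smul (z : ℂ) (a : AdForm σ E.toCocycle (lieAlgebra G)) :
    (z • a).push E hKG ρ = z • a.push E hKG ρ := by
  refine AdForm.ext (funext fun i => funext fun x => ?_)
  ext1 v
  exact map_smul ρ.differential z _

theorem AdForm.push_injective (h : Set.InjOn ρ.differential (lieAlgebra G)) :
    Function.Injective (AdForm.push (σ := σ) E hKG ρ) := by
  intro a b hab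
  refine AdForm.ext (funext fun i => funext fun x => ?_)
  ext1 v
  exact h (a.mem i x v) (b.mem i x v)
    (congrArg (fun d : AdForm σ (E.associated hKG ρ) ⊤ => d.val i x v) hab)

/-- In frames the map is composition with the constant linear map `dρ`, which commutes with
differentiation. Both bundles have the same open cover, hence the same seminorm data. -/
theorem AdForm.supSeminorm_push_le (a : AdForm σ E.toCocycle (lieAlgebra G))
    (s : AdForm.SeminormIndex (E.associated hKG ρ)) :
    AdForm.supSeminorm s (a.push E hKG ρ) ≤ ‖ρ.differential.restrictScalars ℝ‖ *
      AdForm.supSeminorm (c := E.toCocycle) ⟨s.i, s.e, s.he, s.k, s.C, s.compact, s.subset⟩ a := by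
  set s' : AdForm.SeminormIndex E.toCocycle := ⟨s.i, s.e, s.he, s.k, s.C, s.compact, s.subset⟩
  refine Real.iSup_le (fun z => ?_) (mul_nonneg (ContinuousLinearMap.opNorm_nonneg _)
    (apply_nonneg _ _))
  have h1 := (ρ.differential.restrictScalars ℝ).norm_iteratedFDeriv_comp_left
    (a.contDiffAt_coeff s' z) (n := s.k) (by exact_mod_cast le_top)
  exact h1.trans (mul_le_mul_of_nonneg_left (le_ciSup (a.bddAbove_coeff s') z)
    (ContinuousLinearMap.opNorm_nonneg _))

theorem AdForm.continuous_push : Continuous (AdForm.push (σ := σ) E hKG ρ) := by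
  refine continuous_iff_continuousAt.2 fun a => AdForm.tendsto_nhds_iff.2 fun s => ?_
  have h1 := AdForm.tendsto_nhds_iff.1 (tendsto_id (x := 𝓝 a))
    (⟨s.i, s.e, s.he, s.k, s.C, s.compact, s.subset⟩ : AdForm.SeminormIndex E.toCocycle)
  refine squeeze_zero (fun b => apply_nonneg _ _) (fun b => ?_)
    (by simpa using h1.const_mul ‖ρ.differential.restrictScalars ℝ‖)
  rw [← AdForm.push_sub]
  exact AdForm.supSeminorm_push_le _ s

/-- The differential of `φ`, which does not depend on the point. -/
def pushTangent (E : PrincipalBundle ι X K) (hKG : K ≤ G) (ρ : RationalRep G V) :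
    HiggsTangent E.toCocycle (lieAlgebra G) →ₗ[ℂ] HiggsTangent (E.associated hKG ρ) ⊤ where
  toFun u := (u.1.push E hKG ρ, u.2.push E hKG ρ)
  map_add' u v := by
    have h : ∀ {σ : ℂ →+* ℂ} (a b : AdForm σ E.toCocycle (lieAlgebra G)),
        (a + b).push E hKG ρ = a.push E hKG ρ + b.push E hKG ρ := by
      intro σ a b
      rw [eq_comm, ← eq_sub_iff_add_eq, ← AdForm.push_sub, add_sub_cancel_right]
    exact Prod.ext (h _ _) (h _ _)
  map_smul' z u := Prod.ext (AdForm.push_smul z u.1) (AdForm.push_smul z u.2)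

theorem continuous_pushTangent : Continuous (pushTangent E hKG ρ) :=
  (AdForm.continuous_push.comp continuous_fst).prodMk (AdForm.continuous_push.comp continuous_snd)

theorem pushTangent_injective (h : Set.InjOn ρ.differential (lieAlgebra G)) :
    Function.Injective (pushTangent E hKG ρ) := fun _ _ huv =>
  Prod.ext (AdForm.push_injective h (congrArg Prod.fst huv))
    (AdForm.push_injective h (congrArg Prod.snd huv))

theorem pushTangent_real_smul (r : ℝ) (u : HiggsTangent E.toCocycle (lieAlgebra G)) :
    pushTangent E hKG ρ (r • u) = r • pushTangent E hKG ρ u :=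
  (pushTangent E hKG ρ).map_smul (r : ℂ) u

/-- This is the affineness of `φ`; injectivity and the transport of velocities follow from it. -/
theorem higgsEmbedding_vsub (p q : HiggsSpace E.toCocycle (lieAlgebra G)) :
    higgsEmbedding E hKG ρ p -ᵥ higgsEmbedding E hKG ρ q = pushTangent E hKG ρ (p -ᵥ q) := by
  refine Prod.ext (AdForm.ext (funext fun i => funext fun x => ?_))
    (AdForm.push_sub p.higgs q.higgs).symm
  ext1 v
  exact (map_sub ρ.differential _ _).symm

theorem higgsEmbedding_injective (h : Set.InjOn ρ.differential (lieAlgebra G)) :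
    Function.Injective (higgsEmbedding E hKG ρ) := by
  intro p q hpq
  have h1 := higgsEmbedding_vsub (hKG := hKG) (ρ := ρ) p q
  rw [hpq, higgsEmbedding_vsub] at h1
  have h2 := pushTangent_injective h h1
  rw [← HiggsSpace.vsub_vadd_cancel p q, ← h2, HiggsSpace.vsub_vadd_cancel]

theorem HasVelocity.higgsEmbedding {γ : ℝ → HiggsSpace E.toCocycle (lieAlgebra G)}
    {w : HiggsTangent E.toCocycle (lieAlgebra G)} {t : ℝ} (hγ : HasVelocity γ w t) :
    HasVelocity (higgsEmbedding E hKG ρ ∘ γ) (pushTangent E hKG ρ w) t := by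
  refine (((continuous_pushTangent (hKG := hKG) (ρ := ρ)).tendsto w).comp hγ).congr fun s => ?_
  rw [Function.comp_apply, pushTangent_real_smul, ← higgsEmbedding_vsub]
  rfl

theorem HasVelocity.pushTangent {γ : ℝ → HiggsTangent E.toCocycle (lieAlgebra G)}
    {w : HiggsTangent E.toCocycle (lieAlgebra G)} {t : ℝ} (hγ : HasVelocity γ w t) :
    HasVelocity (pushTangent E hKG ρ ∘ γ) (pushTangent E hKG ρ w) t := by
  refine (((continuous_pushTangent (hKG := hKG) (ρ := ρ)).tendsto w).comp hγ).congr fun s => ?_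
  rw [Function.comp_apply, pushTangent_real_smul, vsub_eq_sub, map_sub]
  rfl

end Pushforward

/-! ### Uniqueness of the flat connection -/

section Connections

/-- The Levi-Civita connection of a translation invariant definite metric is the flat one. -/
theorem IsLeviCivita.eq_zero {E P : Type*} [AddCommGroup E] [Module ℝ E] [AddAction E P]
    {g : P → E → E → ℝ} {Γ : P → E →ₗ[ℝ] E →ₗ[ℝ] E} (hΓ : IsLeviCivita g Γ)
    (hconst : ∀ p q u v, g p u v = g q u v) (hsymm : ∀ p u v, g p u v = g p v u)
    (hdef : ∀ p u, g p u u = 0 → u = 0) : Γ = 0 := by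
  have h1 : ∀ p u v w, g p (Γ p u v) w = -g p (Γ p u w) v := by
    intro p u v w
    have h2 := (hΓ.metric p u v w).unique ((hasDerivAt_const (0 : ℝ) (g p v w)).congr_of_eventuallyEq
      (Filter.Eventually.of_forall fun t => hconst _ _ v w))
    rw [hsymm p v] at h2
    exact eq_neg_of_add_eq_zero_left h2
  -- `g(Γ(u, v), w)` is symmetric in `u, v` and skew in `v, w`. Alternating the two rules three
  -- times returns to the start with the opposite sign.
  have h3 : ∀ p u v w, g p (Γ p u v) w = 0 := by
    intro p u v w
    have e1 := h1 p u v w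
    have e2 := h1 p w u v
    have e3 := h1 p v w u
    rw [hΓ.torsionFree p w u] at e2
    rw [hΓ.torsionFree p v w, hΓ.torsionFree p v u] at e3
    linarith
  funext p
  ext u v
  exact hdef p _ (h3 p u v _)

end Connections

end PrincipalHiggs

end

/-! ### The theorem -/

open PrincipalHiggs in
theorem mainTheorem8
    {U : Type*} [NormedAddCommGroup U] [NormedSpace ℂ U] [FiniteDimensional ℂ U]
    {V : Type*} [NormedAddCommGroup V] [NormedSpace ℂ V] [FiniteDimensional ℂ V]
    -- a connected reductive group `G ⊆ GL(U)` and a maximal compact subgroup `K`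
    (G : Subgroup (GLin U)) (hG : IsConnectedReductive G)
    (K : Subgroup (GLin U)) (hK : IsMaximalCompact K G)
    -- a faithful representation of `G` and a maximal compact subgroup of `GL(V)`
    (ρ : RationalRep G V) (hρ : Function.Injective ρ.toHom)
    (K' : Subgroup (GLin V)) (hK' : IsMaximalCompact K' ⊤)
    (hKK' : ∀ g : G, (g : GLin U) ∈ K → ρ.toHom g ∈ K')
    -- a compact connected Riemann surface and a principal `K`-bundle
    {X : Type*} [TopologicalSpace X] [T2Space X] [CompactSpace X] [ConnectedSpace X]
    [ChartedSpace ℂ X] [IsManifold 𝓘(ℂ, ℂ) ω X]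
    {ι : Type*} (E : PrincipalBundle ι X K) :
    ∃ dφ : HiggsSpace E.toCocycle (lieAlgebra G) → HiggsTangent E.toCocycle (lieAlgebra G) →
        HiggsTangent (E.associated hK.le ρ) ⊤,
      Function.Injective (higgsEmbedding E hK.le ρ) ∧
      IsDifferential (higgsEmbedding E hK.le ρ) dφ ∧
      (∀ p u v, kaehlerForm (innerEnd K') (higgsEmbedding E hK.le ρ p) (dφ p u) (dφ p v) =
        kaehlerForm (innerLie K ρ) p u v) ∧
      ∀ Γ₀ Γ₁, IsLeviCivita (riemannianMetric (c := E.toCocycle) (𝔤 := lieAlgebra G)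
          (innerLie K ρ)) Γ₀ →
        IsLeviCivita (riemannianMetric (c := E.associated hK.le ρ) (𝔤 := ⊤) (innerEnd K')) Γ₁ →
        (∀ II, IsSecondFundamentalForm (riemannianMetric (innerEnd K')) Γ₁
          (higgsEmbedding E hK.le ρ) dφ II ↔ II = 0) ∧
        IsTotallyGeodesic Γ₀ Γ₁ (higgsEmbedding E hK.le ρ) := by
  have hinj : Set.InjOn ρ.differential (lieAlgebra G) :=
    RationalRep.differential_injOn hG hK hρ hK' hKK'
  have hh := isHermitianInner_innerEnd hK'
  -- The transition functions of `W` lie in `ρ(K) ⊆ K'`.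
  have hc : IsInvariantInner (E.associated hK.le ρ) (innerEnd K') := fun i j x _ A B =>
    innerEnd_conj hK' (hKK' _ (E.mem i j x)) A B
  have hmetric : ∀ (p : HiggsSpace E.toCocycle (lieAlgebra G))
      (u v : HiggsTangent E.toCocycle (lieAlgebra G)),
      riemannianMetric (innerEnd K') (higgsEmbedding E hK.le ρ p) (pushTangent E hK.le ρ u)
        (pushTangent E hK.le ρ v) = riemannianMetric (innerLie K ρ) p u v := by
    intro p u v
    -- Both wedge products use the same chosen frame at `x`, since the associated bundle inherits
    -- the cover of `E`.
    have h1 : ∀ {σ : ℂ →+* ℂ} (a b : AdForm σ E.toCocycle (lieAlgebra G)),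
        wedgeConj (innerEnd K') (a.push E hK.le ρ) (b.push E hK.le ρ) =
          wedgeConj (innerLie K ρ) a b := by
      intro σ a b
      funext x v w
      have h2 := fun v w => RationalRep.innerEnd_differential hG hK hK' hKK'
        (a.mem (E.cover x).choose x v) (b.mem (E.cover x).choose x w)
      exact congrArg₂ (· - ·) (h2 v w) (h2 w v)
    simp only [riemannianMetric, hermitianProduct, pushTangent, LinearMap.coe_mk, AddHom.coe_mk, h1]
  refine ⟨fun _ => pushTangent E hK.le ρ, higgsEmbedding_injective hinj,
    fun p u => (hasVelocity_line u p).higgsEmbedding, fun p u v => ?_, fun Γ₀ Γ₁ hΓ₀ hΓ₁ => ?_⟩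
  · rw [kaehlerForm, kaehlerForm, ← hmetric p, map_smul]
  -- Symmetry and definiteness on `𝓑₀` are pulled back along the isometric injection `dφ`.
  · have e₀ : Γ₀ = 0 := hΓ₀.eq_zero (fun _ _ _ _ => rfl)
      (fun p u v => by
        rw [← hmetric p, ← hmetric p, riemannianMetric_symm hh])
      (fun p u hu => by
        rw [← hmetric p] at hu
        exact pushTangent_injective hinj
          ((eq_zero_of_riemannianMetric_self hh hc _ hu).trans (map_zero _).symm))
    have e₁ : Γ₁ = 0 := hΓ₁.eq_zero (fun _ _ _ _ => rfl) (riemannianMetric_symm hh)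
      (fun p u hu => eq_zero_of_riemannianMetric_self hh hc p hu)
    subst e₀ e₁
    refine ⟨fun II => ⟨fun hII => ?_, ?_⟩, ?_⟩
    · funext p u v
      obtain ⟨h1, D, hD, w, hw⟩ := hII p u v
      have hD0 : D = 0 := eq_zero_of_hasVelocity_const hD
      -- With `D = 0` and the flat connection, the normal component is also tangent to the image, so
      -- pairing it with itself gives zero.
      have h2 : II p u v = pushTangent E hK.le ρ (-w) := by
        rw [map_neg]
        refine eq_neg_of_add_eq_zero_right (hw.symm.trans ?_)
        rw [hD0]
        exact add_zero 0
      have h3 := h1 (-w)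
      beta_reduce at h3
      rw [← h2] at h3
      exact eq_zero_of_riemannianMetric_self hh hc _ h3
    · rintro rfl p u v
      refine ⟨fun w => riemannianMetric_zero_left hh _ _, 0, hasVelocity_const _ _, 0, ?_⟩
      beta_reduce
      rw [map_zero]
      rfl
    · rintro γ a b ⟨γ', γ'', hγ⟩
      refine ⟨pushTangent E hK.le ρ ∘ γ', pushTangent E hK.le ρ ∘ γ'', fun t ht => ?_⟩
      obtain ⟨h1, h2, h3⟩ := hγ t ht
      -- For the flat connection the geodesic equation says that the acceleration vanishes.
      have h4 : γ'' t = 0 := (add_zero _).symm.trans h3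
      refine ⟨h1.higgsEmbedding, h2.pushTangent, ?_⟩
      rw [Function.comp_apply, h4, map_zero]
      exact add_zero 0
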